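/- Let $p$ be a prime number, let $k$ be a field of characteristic $p$, and let $$\hat\Gamma=\bigl(\mathrm{PGL}_2(k)\times \mathrm{PGL}_2(k)\bigr)\rtimes \mu_2,$$ where $\mu_2$ is the cyclic group of order $2$ whose non-trivial element acts by interchanging the two factors. For a finite group $G$, let $G_{(p)}$ denote a Sylow $p$-subgroup of $G$. Then every finite subgroup $G$ of $\hat\Gamma$ contains a normal abelian subgroup of order coprime to $p$ and of index in $G$ at most $J_p\cdot |G_{(p)}|^3$, where $$J_p=\begin{cases}7200, & p\geqslant 7,\\ 72, & p=5,\\ 10, & p=3,\\ 1, & p=2.\end{cases}$$ -/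

import Mathlib

/-- The action of the cyclic group of order two on `H × H` whose non-trivial element
interchanges the two factors. The cyclic group is the abstract one, so it has order two over
fields of every characteristic. -/
def swapAction (H : Type*) [Group H] : Multiplicative (ZMod 2) →* MulAut (H × H) where
  toFun t := if t = 1 then 1 else MulEquiv.prodComm
  map_one' := by simp
  map_mul' s t := by
    have key : ∀ x : Multiplicative (ZMod 2), x = 1 ∨ x = Multiplicative.ofAdd 1 := by decide
    have hne : (Multiplicative.ofAdd 1 : Multiplicative (ZMod 2)) ≠ 1 := by decide
    have hsq : (Multiplicative.ofAdd 1 : Multiplicative (ZMod 2)) * Multiplicative.ofAdd 1 = 1 := by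
      decide
    rcases key s with rfl | rfl <;> rcases key t with rfl | rfl
    · simp
    · simp
    · simp
    · rw [hsq, if_pos rfl, if_neg hne]
      ext x <;> rfl

/-- The group `(PGL₂(k) × PGL₂(k)) ⋊ μ₂`, where `μ₂` interchanges the factors. -/
abbrev PGLTwoSwap (k : Type*) [Field k] : Type _ :=
  (Matrix.ProjGenLinGroup (Fin 2) k × Matrix.ProjGenLinGroup (Fin 2) k)
    ⋊[swapAction (Matrix.ProjGenLinGroup (Fin 2) k)] Multiplicative (ZMod 2)

/-- The constant attached to a prime `p`: it is `7200` if `p ≥ 7`, and `72`, `10`, `1` if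
`p = 5`, `p = 3`, `p = 2` respectively. (Only prime values of `p` matter.) -/
def jordanConst (p : ℕ) : ℕ :=
  if 7 ≤ p then 7200 else if p = 5 then 72 else if p = 3 then 10 else 1

/-! Over an algebraic closure, `PGL₂` acts on the projective line so that an element g ≠ 1 has one
fixed point if g^p = 1 (call it unipotent) and two otherwise; the unipotent elements fixing a given
point form a subgroup, which contains all commutators of the stabilizer. `IsMoebiusAction` records
these properties, and the analysis of a single factor uses nothing else. Counting pairs (g, x) with
gx = x gives a Riemann–Hurwitz formula (`sum_ramified`, `exists_orbit_representatives`).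

If p does not divide |G|, the formula leaves a trivial group, a global fixed point, a point
stabilizer of index two, the tetrahedral and octahedral types, or order 60 (`tame_cases`). If p
divides |G|, the nontrivial unipotent stabilizers are the Sylow p-subgroups, of order q, and |G| ≤
q³ unless q = 2, when an abelian subgroup of odd order has index two, or q = 3 and |G| = 60
(`wild_cases`).

Hence G has a normal abelian p'-subgroup N with [B : B ∩ N] ≤ (c/27)·|B_(p)|³ for every normal B,
where c is `pglTwoConst p` (`exists_jordan_subgroup`). Allowing all B makes the bound
multiplicative. For K with homomorphisms f₁, f₂, put D = f₁⁻¹(N₁); then f₁⁻¹(N₁) ∩ f₂⁻¹(N₂) has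
index [f₁K : N₁]·[f₂D : f₂D ∩ N₂], and the p-parts of [K : D] and |D| multiply to that of |K|
(`index_comap_inf_comap_le`).

The interchange of factors costs at most a factor 2. For odd p this gives 2(c/27)² ≤ J_p; for p = 2
the factor is absorbed by the larger Sylow subgroup. Normality under the interchange comes from
taking N₂ conjugate to N₁ (`exists_compatible_jordan`). -/

open MulAction

/-! ### Möbius-type actions: fixed points and unipotent stabilizers -/

open Classical in
/-- An action of a group `G` in which fixed points behave as for the action of
`PGL₂` of an algebraically closed field of characteristic `p` on the projective line. -/
structure IsMoebiusAction (p : ℕ) (G X : Type*) [Group G] [MulAction G X] : Prop where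
  ncard_fixedBy : ∀ g : G, g ≠ 1 → (fixedBy X g).ncard = if g ^ p = 1 then 1 else 2
  mul_pow_eq_one : ∀ (x : X) (g h : G), g • x = x → h • x = x → g ^ p = 1 → h ^ p = 1 →
    (g * h) ^ p = 1
  commutator_pow_eq_one : ∀ (x : X) (g h : G), g • x = x → h • x = x →
    (g * h * g⁻¹ * h⁻¹) ^ p = 1

namespace IsMoebiusAction

variable {p : ℕ} {G X : Type*} [Group G] [MulAction G X]

theorem subgroup (hG : IsMoebiusAction p G X) (B : Subgroup G) : IsMoebiusAction p B X where
  ncard_fixedBy g hg := by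
    have h := hG.ncard_fixedBy (g : G) (by simpa using hg)
    have h2 : (g ^ p = 1) ↔ ((g : G) ^ p = 1) := by
      rw [← Subgroup.coe_pow, OneMemClass.coe_eq_one]
    change (fixedBy X (g : G)).ncard = _
    rw [h]
    by_cases h3 : g ^ p = 1
    · rw [if_pos h3, if_pos (h2.mp h3)]
    · rw [if_neg h3, if_neg (mt h2.mpr h3)]
  mul_pow_eq_one x g h hg hh h1 h2 := by
    have := hG.mul_pow_eq_one x (g : G) (h : G) hg hh (by simpa using congrArg Subtype.val h1)
      (by simpa using congrArg Subtype.val h2)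
    exact Subtype.ext (by simpa using this)
  commutator_pow_eq_one x g h hg hh := by
    have := hG.commutator_pow_eq_one x (g : G) (h : G) hg hh
    exact Subtype.ext (by simpa using this)

theorem eq_of_fixed_of_pow_eq_one (hG : IsMoebiusAction p G X) {u : G} (hu : u ≠ 1)
    (hup : u ^ p = 1) {x y : X} (hx : u • x = x) (hy : u • y = y) : y = x := by
  have h := hG.ncard_fixedBy u hu
  rw [if_pos hup, Set.ncard_eq_one] at h
  obtain ⟨z, hz⟩ := h
  have h1 : x ∈ fixedBy X u := hx
  have h2 : y ∈ fixedBy X u := hy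
  rw [hz] at h1 h2
  rw [h1, h2]

/-- `Set.ncard` is 0 on infinite sets, so the values 1 and 2 force finiteness. -/
theorem finite_fixedBy (hG : IsMoebiusAction p G X) {g : G} (hg : g ≠ 1) :
    (fixedBy X g).Finite := by
  apply Set.finite_of_ncard_ne_zero
  rw [hG.ncard_fixedBy g hg]
  split_ifs <;> simp

theorem exists_other_fixed (hG : IsMoebiusAction p G X) {g : G} (hg : g ^ p ≠ 1) {x : X}
    (hx : g • x = x) : ∃ y, y ≠ x ∧ fixedBy X g = {x, y} := by
  have h1 : g ≠ 1 := by rintro rfl; simp at hg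
  have h := hG.ncard_fixedBy g h1
  rw [if_neg hg, Set.ncard_eq_two] at h
  obtain ⟨a, b, hab, h⟩ := h
  have hxm : x ∈ fixedBy X g := hx
  rw [h] at hxm
  rcases hxm with rfl | rfl
  · exact ⟨b, hab.symm, h⟩
  · exact ⟨a, hab, by rw [h, Set.pair_comm]⟩

theorem exists_fixed (hG : IsMoebiusAction p G X) {g : G} (hg : g ≠ 1) : ∃ x : X, g • x = x := by
  have h := hG.ncard_fixedBy g hg
  have : (fixedBy X g).Nonempty := by
    apply Set.nonempty_of_ncard_ne_zero
    rw [h]; split_ifs <;> simp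
  exact this

/-- An element commuting with a nontrivial unipotent element fixes the same point and is
unipotent. -/
theorem of_commute (hG : IsMoebiusAction p G X) {u h : G} (hu : u ≠ 1)
    (hup : u ^ p = 1) {x : X} (hx : u • x = x) (hc : h * u = u * h) :
    h • x = x ∧ h ^ p = 1 := by
  have h1 : h • x = x := by
    apply hG.eq_of_fixed_of_pow_eq_one hu hup hx
    rw [← mul_smul, ← hc, mul_smul, hx]
  refine ⟨h1, ?_⟩
  -- Otherwise h has a second fixed point y. As u permutes the fixed points of h and fixes x, it
  -- fixes y too, which a unipotent u ≠ 1 cannot do.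
  by_contra hp
  obtain ⟨y, hyx, hy⟩ := hG.exists_other_fixed hp h1
  have hhy : h • y = y := by
    have : y ∈ fixedBy X h := by rw [hy]; simp
    exact this
  have h2 : u • y ∈ fixedBy X h := by
    change h • u • y = u • y
    rw [← mul_smul, hc, mul_smul, hhy]
  rw [hy] at h2
  rcases h2 with h2 | h2
  · apply hyx
    rw [← hx] at h2
    exact smul_left_cancel u h2
  · exact hyx (hG.eq_of_fixed_of_pow_eq_one hu hup hx h2)

/-- Otherwise some power u of g has order p and a single fixed point, yet the two fixed points of g
are fixed by u. -/
theorem not_dvd_orderOf [Finite G] (hp : p.Prime) (hG : IsMoebiusAction p G X) {g : G}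
    (hg : g ^ p ≠ 1) : ¬ p ∣ orderOf g := by
  intro hd
  have hn : orderOf g ≠ 0 := (orderOf_pos g).ne'
  have ho : orderOf (g ^ (orderOf g / p)) = p := orderOf_pow_orderOf_div hn hd
  set u := g ^ (orderOf g / p) with hu
  have hu1 : u ≠ 1 := by
    intro h
    rw [h, orderOf_one] at ho
    exact hp.one_lt.ne ho
  have hup : u ^ p = 1 := by rw [← ho]; exact pow_orderOf_eq_one u
  have g1 : g ≠ 1 := by rintro rfl; simp at hg
  have hsub : fixedBy X g ⊆ fixedBy X u := by
    intro x hx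
    have h := fixedBy_subset_fixedBy_zpow X g ((orderOf g / p : ℕ) : ℤ) hx
    rwa [zpow_natCast] at h
  have := Set.ncard_le_ncard hsub (hG.finite_fixedBy hu1)
  rw [hG.ncard_fixedBy g g1, hG.ncard_fixedBy u hu1, if_pos hup, if_neg hg] at this
  omega

/-- The subgroup of unipotent elements of the stabilizer of a point. -/
def unipotentStabilizer (hG : IsMoebiusAction p G X) (x : X) : Subgroup G where
  carrier := {g | g • x = x ∧ g ^ p = 1}
  mul_mem' := fun {a b} ha hb => ⟨by rw [mul_smul, hb.1, ha.1],
    hG.mul_pow_eq_one x a b ha.1 hb.1 ha.2 hb.2⟩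
  one_mem' := ⟨one_smul _ _, one_pow _⟩
  inv_mem' := fun {a} ha => ⟨by rw [inv_smul_eq_iff, ha.1], by rw [inv_pow, ha.2, inv_one]⟩

theorem mem_unipotentStabilizer (hG : IsMoebiusAction p G X) {x : X} {g : G} :
    g ∈ hG.unipotentStabilizer x ↔ g • x = x ∧ g ^ p = 1 := Iff.rfl

theorem unipotentStabilizer_le (hG : IsMoebiusAction p G X) (x : X) :
    hG.unipotentStabilizer x ≤ stabilizer G x := fun _ h => h.1

theorem isPGroup_unipotentStabilizer (hG : IsMoebiusAction p G X) (x : X) :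
    IsPGroup p (hG.unipotentStabilizer x) := fun g =>
  ⟨1, Subtype.ext (by simpa using g.2.2)⟩

theorem unipotentStabilizer_eq_bot_of_not_dvd [Finite G] (hp : p.Prime)
    (hG : IsMoebiusAction p G X) (h : ¬ p ∣ Nat.card G) (x : X) :
    hG.unipotentStabilizer x = ⊥ := by
  rw [eq_bot_iff]
  rintro g ⟨-, hg⟩
  rw [Subgroup.mem_bot]
  rcases (Nat.dvd_prime hp).mp (orderOf_dvd_of_pow_eq_one hg) with h1 | h1
  · exact orderOf_eq_one_iff.mp h1
  · exact absurd (h1 ▸ orderOf_dvd_natCard g) h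

theorem mul_comm_of_unipotentStabilizer_eq_bot (hG : IsMoebiusAction p G X) {x : X}
    (h : hG.unipotentStabilizer x = ⊥) {a b : G} (ha : a • x = x) (hb : b • x = x) :
    a * b = b * a := by
  have h1 : a * b * a⁻¹ * b⁻¹ ∈ hG.unipotentStabilizer x := by
    refine ⟨?_, hG.commutator_pow_eq_one x a b ha hb⟩
    have ha' : a⁻¹ • x = x := by rw [inv_smul_eq_iff, ha]
    have hb' : b⁻¹ • x = x := by rw [inv_smul_eq_iff, hb]
    simp only [mul_smul, ha, hb, ha', hb']
  rw [h, Subgroup.mem_bot] at h1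
  rwa [mul_inv_eq_one, mul_inv_eq_iff_eq_mul] at h1

theorem conj_pow_eq_one_iff {g u : G} : (g * u * g⁻¹) ^ p = 1 ↔ u ^ p = 1 := by
  rw [conj_pow]
  simp

theorem unipotentStabilizer_smul (hG : IsMoebiusAction p G X) (g : G) (x : X) :
    hG.unipotentStabilizer (g • x) = (hG.unipotentStabilizer x).map (MulAut.conj g).toMonoidHom := by
  ext u
  rw [Subgroup.mem_map]
  constructor
  · rintro ⟨h1, h2⟩
    refine ⟨g⁻¹ * u * g, ⟨?_, ?_⟩, by simp [mul_assoc]⟩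
    · rw [mul_smul, mul_smul, h1, inv_smul_smul]
    · have : g⁻¹ * u * g = g⁻¹ * u * (g⁻¹)⁻¹ := by simp
      rw [this, conj_pow_eq_one_iff]; exact h2
  · rintro ⟨v, ⟨h1, h2⟩, rfl⟩
    refine ⟨?_, ?_⟩
    · simp [mul_smul, h1]
    · simpa using h2

theorem card_unipotentStabilizer_smul (hG : IsMoebiusAction p G X) (g : G) (x : X) :
    Nat.card (hG.unipotentStabilizer (g • x)) = Nat.card (hG.unipotentStabilizer x) := by
  rw [unipotentStabilizer_smul]
  exact Subgroup.card_map_of_injective (MulAut.conj g).injective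

theorem card_stabilizer_smul (g : G) (x : X) :
    Nat.card (stabilizer G (g • x)) = Nat.card (stabilizer G x) := by
  rw [stabilizer_smul_eq_stabilizer_map_conj]
  exact Subgroup.card_map_of_injective (MulAut.conj g).injective

end IsMoebiusAction

/-! ### The Riemann–Hurwitz formula -/

namespace IsMoebiusAction

variable {p : ℕ} {G X : Type*} [Group G] [MulAction G X]

/-- The points with nontrivial stabilizer. -/
def ramified (G X : Type*) [Group G] [MulAction G X] : SubMulAction G X where
  carrier := {x | stabilizer G x ≠ ⊥}
  smul_mem' g x hx := by
    intro h
    apply hx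
    rw [stabilizer_smul_eq_stabilizer_map_conj,
      Subgroup.map_eq_bot_iff_of_injective _ (MulAut.conj g).injective] at h
    exact h

theorem mem_ramified_of_smul_eq {x : X} {g : G} (hg : g ≠ 1) (hx : g • x = x) :
    x ∈ ramified G X := by
  intro h
  have : g ∈ stabilizer G x := hx
  rw [h, Subgroup.mem_bot] at this
  exact hg this

theorem finite_ramified [Finite G] (hG : IsMoebiusAction p G X) : Finite (ramified G X) := by
  have h : (⋃ g ∈ {g : G | g ≠ 1}, fixedBy X g).Finite :=
    Set.Finite.biUnion (Set.toFinite _) fun g hg => hG.finite_fixedBy hg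
  refine (h.subset ?_ : Set.Finite (ramified G X : Set X)).to_subtype
  intro x hx
  obtain ⟨g, hg, hg1⟩ := (Subgroup.bot_or_exists_ne_one (stabilizer G x)).resolve_left hx
  exact Set.mem_biUnion (show g ∈ {g : G | g ≠ 1} from hg1) hg

open Classical in
theorem sum_ramified [Fintype G] [Fintype (ramified G X)] (hG : IsMoebiusAction p G X) :
    ∑ x : ramified G X, ((Nat.card (stabilizer G (x : X)) : ℚ) +
      Nat.card (hG.unipotentStabilizer (x : X)) - 2) = 2 * (Nat.card G - 1) := by
  -- The weight is 0 at the identity, 2 at the other unipotent elements and 1 elsewhere. Weight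
  -- times number of fixed points is therefore 2 for every g ≠ 1; exchanging the two sums gives the
  -- formula.
  set w : G → ℚ := fun g => (1 + if g ^ p = 1 then 1 else 0) - if g = 1 then 2 else 0 with hw
  have h1 : ∀ x : X, ((Nat.card (stabilizer G x) : ℚ) +
      Nat.card (hG.unipotentStabilizer x) - 2) = ∑ g : G, if g • x = x then w g else 0 := by
    intro x
    have e1 : (Nat.card (stabilizer G x) : ℚ) = ∑ g : G, if g • x = x then 1 else 0 := by
      rw [Nat.card_eq_fintype_card, Fintype.card_subtype]
      simp [MulAction.mem_stabilizer_iff]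
    have e2 : (Nat.card (hG.unipotentStabilizer x) : ℚ) =
        ∑ g : G, if g • x = x ∧ g ^ p = 1 then 1 else 0 := by
      rw [Nat.card_eq_fintype_card, Fintype.card_subtype]
      simp [mem_unipotentStabilizer]
    have e3 : (2 : ℚ) = ∑ g : G, if g = 1 then 2 else 0 := by simp
    rw [e1, e2]
    nth_rewrite 1 [e3]
    rw [← Finset.sum_add_distrib, ← Finset.sum_sub_distrib]
    refine Finset.sum_congr rfl fun g _ => ?_
    by_cases hx : g • x = x
    · simp [hx, hw]
    · have : g ≠ 1 := by rintro rfl; simp at hx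
      simp [hx, this]
  have h2 : ∀ g : G, (∑ x : ramified G X, if g • (x : X) = x then w g else 0) =
      if g = 1 then 0 else 2 := by
    intro g
    by_cases hg : g = 1
    · subst hg
      simp [hw]
      ring
    · have hc : (Finset.univ.filter fun x : ramified G X => g • (x : X) = x).card =
          (fixedBy X g).ncard := by
        rw [← Set.ncard_coe_finset, ← Set.ncard_image_of_injective _ Subtype.val_injective]
        congr 1
        ext y
        simp only [Finset.coe_filter, Finset.mem_univ, true_and, Set.mem_image, Set.mem_ofPred_eq,
          mem_fixedBy]
        constructor
        · rintro ⟨x, hx, rfl⟩; exact hx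
        · intro hy; exact ⟨⟨y, mem_ramified_of_smul_eq hg hy⟩, hy, rfl⟩
      rw [← Finset.sum_filter, Finset.sum_const, hc, hG.ncard_fixedBy g hg, if_neg hg]
      by_cases hgp : g ^ p = 1
      · simp [hw, hg, hgp]; norm_num
      · simp [hw, hg, hgp]
  simp_rw [h1]
  rw [Finset.sum_comm]
  simp_rw [h2]
  rw [← Finset.sum_erase_add _ _ (Finset.mem_univ (1 : G)), if_pos rfl, add_zero,
    Finset.sum_congr rfl (g := fun _ => (2 : ℚ)) (fun x hx => if_neg (Finset.ne_of_mem_erase hx)),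
    Finset.sum_const, Finset.card_erase_of_mem (Finset.mem_univ _), Finset.card_univ,
    Nat.card_eq_fintype_card, nsmul_eq_mul, Nat.cast_sub Fintype.card_pos]
  push_cast
  ring

/-- Orbit representatives of the points with nontrivial stabilizer, and the resulting
Riemann–Hurwitz type formula. -/
theorem exists_orbit_representatives [Finite G] (hG : IsMoebiusAction p G X) :
    ∃ (n : ℕ) (x : Fin n → X), (∀ i, stabilizer G (x i) ≠ ⊥) ∧
      (∀ y, stabilizer G y ≠ ⊥ → ∃ i, y ∈ orbit G (x i)) ∧
      (∀ i j, x i ∈ orbit G (x j) → i = j) ∧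
      Monotone (fun i => Nat.card (stabilizer G (x i))) ∧
      ∑ i, (1 + ((Nat.card (hG.unipotentStabilizer (x i)) : ℚ) - 2) /
        Nat.card (stabilizer G (x i))) = 2 - 2 / Nat.card G := by
  classical
  have := hG.finite_ramified
  have := Fintype.ofFinite G
  have := Fintype.ofFinite (ramified G X)
  have := Fintype.ofFinite (orbitRel.Quotient G (ramified G X))
  set Q := orbitRel.Quotient G (ramified G X) with hQ
  let r : Q → X := fun ω => (ω.out : ramified G X)
  let e0 : Fin (Fintype.card Q) ≃ Q := (Fintype.equivFin Q).symm
  let σ := Tuple.sort (fun i => Nat.card (stabilizer G (r (e0 i))))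
  let e : Fin (Fintype.card Q) ≃ Q := σ.trans e0
  have horb : ∀ y z : ramified G X, (y : X) ∈ orbit G (z : X) ↔
      (Quotient.mk'' y : Q) = Quotient.mk'' z := by
    intro y z
    rw [Quotient.eq'', orbitRel_apply]
    constructor
    · rintro ⟨g, hg⟩; exact ⟨g, Subtype.ext hg⟩
    · rintro ⟨g, hg⟩; exact ⟨g, congrArg Subtype.val hg⟩
  refine ⟨Fintype.card Q, fun i => r (e i), ?_, ?_, ?_, ?_, ?_⟩
  · intro i; exact (e i).out.2
  · intro y hy
    let z : ramified G X := ⟨y, hy⟩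
    refine ⟨e.symm (Quotient.mk'' z), ?_⟩
    apply (horb z _).mpr
    rw [Equiv.apply_symm_apply]
    exact (Quotient.out_eq' _).symm
  · intro i j h
    have := (horb (e i).out (e j).out).mp h
    rw [Quotient.out_eq', Quotient.out_eq'] at this
    exact e.injective this
  · exact Tuple.monotone_sort (fun i => Nat.card (stabilizer G (r (e0 i))))
  · have hg0 : (Nat.card G : ℚ) ≠ 0 := by exact_mod_cast Nat.card_pos.ne'
    have hsum := hG.sum_ramified
    rw [← Finset.sum_fiberwise (s := Finset.univ)
      (g := fun x : ramified G X => (Quotient.mk'' x : Q))] at hsum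
    have hω : ∀ ω : Q, (∑ x : ramified G X with (Quotient.mk'' x : Q) = ω,
        ((Nat.card (stabilizer G (x : X)) : ℚ) +
          Nat.card (hG.unipotentStabilizer (x : X)) - 2)) =
        Nat.card G * (1 + ((Nat.card (hG.unipotentStabilizer (r ω)) : ℚ) - 2) /
          Nat.card (stabilizer G (r ω))) := by
      intro ω
      have hout : (Quotient.mk'' (ω.out : ramified G X) : Q) = ω := Quotient.out_eq' ω
      have hmem : ∀ x : ramified G X, (Quotient.mk'' x : Q) = ω ↔ (x : X) ∈ orbit G (r ω) := by
        intro x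
        rw [horb x ω.out, hout]
      have hs0 : (Nat.card (stabilizer G (r ω)) : ℚ) ≠ 0 := by exact_mod_cast Nat.card_pos.ne'
      rw [Finset.sum_congr rfl (g := fun _ => ((Nat.card (stabilizer G (r ω)) : ℚ) +
          Nat.card (hG.unipotentStabilizer (r ω)) - 2))]
      · rw [Finset.sum_const, nsmul_eq_mul]
        have hc : (Finset.univ.filter fun x : ramified G X => (Quotient.mk'' x : Q) = ω).card =
            Nat.card (orbit G (r ω)) := by
          rw [← Set.ncard_coe_finset, ← Set.ncard_image_of_injective _ Subtype.val_injective,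
            Nat.card_coe_set_eq]
          congr 1
          ext y
          simp only [Finset.coe_filter, Finset.mem_univ, true_and, Set.mem_image,
            Set.mem_ofPred_eq, hmem]
          constructor
          · rintro ⟨x, hx, rfl⟩; exact hx
          · rintro ⟨g, rfl⟩
            exact ⟨g • ω.out, ⟨g, rfl⟩, rfl⟩
        have hos : Nat.card (orbit G (r ω)) * Nat.card (stabilizer G (r ω)) = Nat.card G := by
          rw [← Nat.card_prod]
          exact Nat.card_congr (orbitProdStabilizerEquivGroup G (r ω))
        rw [hc, ← hos]
        push_cast
        field_simp
        ring
      · intro x hx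
        obtain ⟨g, hg⟩ := (hmem x).mp (Finset.mem_filter.mp hx).2
        simp only at hg
        rw [← hg, card_stabilizer_smul, hG.card_unipotentStabilizer_smul]
    simp_rw [hω] at hsum
    rw [← Finset.mul_sum] at hsum
    rw [Equiv.sum_comp e (fun ω => 1 + ((Nat.card (hG.unipotentStabilizer (r ω)) : ℚ) - 2) /
        Nat.card (stabilizer G (r ω)))]
    field_simp
    linarith

end IsMoebiusAction

/-! ### Groups of order prime to p -/

namespace IsMoebiusAction

variable {p : ℕ} {G X : Type*} [Group G] [MulAction G X]

theorem card_stabilizer_of_mem_orbit {x y : X} (h : y ∈ orbit G x) :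
    Nat.card (stabilizer G y) = Nat.card (stabilizer G x) := by
  obtain ⟨g, rfl⟩ := h
  exact card_stabilizer_smul g x

theorem stabilizer_eq_top_of_card [Finite G] {x : X}
    (h : Nat.card (stabilizer G x) = Nat.card G) : stabilizer G x = ⊤ :=
  Subgroup.eq_top_of_card_eq _ h

theorem two_le_card_of_ne_bot [Finite G] {x : X} (h : stabilizer G x ≠ ⊥) :
    2 ≤ Nat.card (stabilizer G x) := by
  rw [← Subgroup.one_lt_card_iff_ne_bot] at h
  exact h

/-- The equation is 1/a + 1/b + 1/c = 1 + 2/g with denominators cleared. The left side is at most 1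
if a ≥ 3, or if a = 2 and b ≥ 4, or if a = 2, b = 3 and c ≥ 6. -/
theorem platonic_arith {a b c g : ℕ} (ha : 2 ≤ a) (hab : a ≤ b) (hbc : b ≤ c)
    (h : g * (b * c + a * c + a * b) = a * b * c * (g + 2)) :
    a = 2 ∧ ((b = 2 ∧ g = 2 * c) ∨ (b = 3 ∧ c = 3 ∧ g = 12) ∨ (b = 3 ∧ c = 4 ∧ g = 24) ∨
      (b = 3 ∧ c = 5 ∧ g = 60)) := by
  have ha2 : a = 2 := by
    by_contra hne
    have ha3 : 3 ≤ a := by omega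
    have h1 : b * c + a * c + a * b ≤ a * b * c := by
      have : 3 * (b * c) ≤ a * b * c := by rw [mul_assoc]; exact Nat.mul_le_mul_right _ ha3
      have h2 : a * c ≤ b * c := Nat.mul_le_mul_right _ hab
      have h3 : a * b ≤ b * c := by rw [mul_comm b c]; exact Nat.mul_le_mul_right _ (hab.trans hbc)
      omega
    have h2 := Nat.mul_le_mul_left g h1
    have h3 : 0 < a * b * c := Nat.mul_pos (Nat.mul_pos (by omega) (by omega)) (by omega)
    nlinarith
  subst ha2
  refine ⟨rfl, ?_⟩
  have hb3 : b ≤ 3 := by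
    by_contra hne
    have hb4 : 4 ≤ b := by omega
    have h1 : 2 * c + 2 * b ≤ b * c := by nlinarith
    have h3 : 0 < b * c := Nat.mul_pos (by omega) (by omega)
    nlinarith
  interval_cases b
  · left
    refine ⟨rfl, ?_⟩
    have : c * g * 2 = c * (2 * c) * 2 := by nlinarith
    have hc : 0 < c := by omega
    have h4 : c * g = c * (2 * c) := by omega
    exact Nat.eq_of_mul_eq_mul_left hc h4
  · have hc5 : c ≤ 5 := by
      by_contra hne
      have hc6 : 6 ≤ c := by omega
      nlinarith
    interval_cases c <;> omega

/-- Each ramified orbit contributes 1 - 1/e ≥ 1/2 to a sum below 2, so there are at most three. No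
orbit means a trivial group, one is impossible, two force a global fixed point, and three give the
platonic equation. In types (2,3,3) and (2,3,4) the orbit of six points is recognized by the order
of its stabilizers, 2 or 4, which does not divide the others. -/
theorem tame_cases [Finite G] (hp : p.Prime) (hG : IsMoebiusAction p G X)
    (hpG : ¬ p ∣ Nat.card G) :
    Nat.card G = 1 ∨ (∃ x : X, stabilizer G x = ⊤) ∨
    (2 ∣ Nat.card G ∧ ∃ x : X, 2 * Nat.card (stabilizer G x) = Nat.card G) ∨
    ((Nat.card G = 12 ∨ Nat.card G = 24) ∧ ∃ x : X, 6 * Nat.card (stabilizer G x) = Nat.card G ∧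
      stabilizer G x ≠ ⊥ ∧
      ∀ y, Nat.card (stabilizer G x) ∣ Nat.card (stabilizer G y) → y ∈ orbit G x) ∨
    Nat.card G = 60 := by
  obtain ⟨n, x, hbot, hcov, hinj, hmono, hsum⟩ := hG.exists_orbit_representatives
  have he2 : ∀ i, 2 ≤ Nat.card (stabilizer G (x i)) := fun i => two_le_card_of_ne_bot (hbot i)
  have hdvd : ∀ i, Nat.card (stabilizer G (x i)) ∣ Nat.card G :=
    fun i => Subgroup.card_subgroup_dvd_card _
  have hq : ∀ i, Nat.card (hG.unipotentStabilizer (x i)) = 1 := fun i => by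
    rw [hG.unipotentStabilizer_eq_bot_of_not_dvd hp hpG]; simp
  have hcov' : ∀ i, (∀ j, Nat.card (stabilizer G (x i)) ∣ Nat.card (stabilizer G (x j)) → j = i) →
      ∀ y, Nat.card (stabilizer G (x i)) ∣ Nat.card (stabilizer G y) → y ∈ orbit G (x i) := by
    intro i hi y hy
    have hyb : stabilizer G y ≠ ⊥ := by
      intro h
      rw [h, Subgroup.card_bot, Nat.dvd_one] at hy
      have := he2 i
      omega
    obtain ⟨j, hj⟩ := hcov y hyb
    rw [card_stabilizer_of_mem_orbit hj] at hy
    rw [← hi j hy]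
    exact hj
  simp only [hq] at hsum
  obtain ⟨e, he'⟩ : ∃ e : Fin n → ℕ, ∀ i, Nat.card (stabilizer G (x i)) = e i := ⟨_, fun _ => rfl⟩
  simp only [he'] at he2 hdvd hcov' hmono hsum
  have hgpos : 0 < Nat.card G := Nat.card_pos
  generalize hgdef : Nat.card G = g at *
  have hgq : (0 : ℚ) < g := by exact_mod_cast hgpos
  have hle : ∀ i, e i ≤ g := fun i => Nat.le_of_dvd hgpos (hdvd i)
  have hn : n ≤ 3 := by
    have h1 : ∀ i ∈ Finset.univ, (1 / 2 : ℚ) ≤ 1 + (((1 : ℕ) : ℚ) - 2) / e i := by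
      intro i _
      have : (2 : ℚ) ≤ e i := by exact_mod_cast he2 i
      rw [← sub_nonneg]
      have h3 : (1 + (((1 : ℕ) : ℚ) - 2) / e i) - 1 / 2 = (e i - 2) / (2 * e i) := by
        field_simp; push_cast; ring
      rw [h3]
      apply div_nonneg <;> linarith
    have h2 := Finset.card_nsmul_le_sum _ _ _ h1
    rw [hsum, Finset.card_univ, Fintype.card_fin, nsmul_eq_mul] at h2
    have h3 : (0 : ℚ) < 2 / g := by positivity
    have h4 : (n : ℚ) < 4 := by linarith
    have : n < 4 := by exact_mod_cast h4
    omega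
  interval_cases n
  · left
    simp only [Finset.univ_eq_empty, Finset.sum_empty] at hsum
    have : (g : ℚ) = 1 := by field_simp at hsum; linarith
    exact_mod_cast this
  · exfalso
    simp only [Fin.sum_univ_one] at hsum
    have h2 := he2 0
    have hl := hle 0
    generalize e 0 = a at *
    have ha0 : (0 : ℚ) < a := by exact_mod_cast (by omega : 0 < a)
    have : (g : ℚ) * (a + 1) = 2 * a := by
      field_simp at hsum; push_cast at hsum; linarith
    have h3 : g * (a + 1) = 2 * a := by exact_mod_cast this
    nlinarith
  · right; left
    simp only [Fin.sum_univ_two] at hsum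
    refine ⟨x 0, stabilizer_eq_top_of_card ?_⟩
    rw [he' 0, hgdef]
    have h2 := he2 0
    have hl := hle 0
    have h2' := he2 1
    have hl' := hle 1
    generalize e 0 = a at *
    generalize e 1 = b at *
    have ha0 : (0 : ℚ) < a := by exact_mod_cast (by omega : 0 < a)
    have hb0 : (0 : ℚ) < b := by exact_mod_cast (by omega : 0 < b)
    have : (g : ℚ) * (a + b) = 2 * a * b := by
      field_simp at hsum; push_cast at hsum; linarith
    have h3 : g * (a + b) = 2 * a * b := by exact_mod_cast this
    have h4 : a * b ≤ g * b := Nat.mul_le_mul_right _ hl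
    have h5 : a * b ≤ a * g := Nat.mul_le_mul_left _ hl'
    have h6 : a * b = g * b := by nlinarith
    exact Nat.eq_of_mul_eq_mul_right (by omega) h6
  · right; right
    simp only [Fin.sum_univ_three] at hsum
    have h01 : e 0 ≤ e 1 := hmono (by decide)
    have h12 : e 1 ≤ e 2 := hmono (by decide)
    have ha0 : (0 : ℚ) < e 0 := by exact_mod_cast (by have := he2 0; omega : 0 < e 0)
    have hb0 : (0 : ℚ) < e 1 := by exact_mod_cast (by have := he2 1; omega : 0 < e 1)
    have hc0 : (0 : ℚ) < e 2 := by exact_mod_cast (by have := he2 2; omega : 0 < e 2)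
    have hQ : (g : ℚ) * (e 1 * e 2 + e 0 * e 2 + e 0 * e 1) = e 0 * e 1 * e 2 * (g + 2) := by
      field_simp at hsum; push_cast at hsum; linarith
    obtain ⟨h0, h⟩ := platonic_arith (he2 0) h01 h12 (by exact_mod_cast hQ)
    rcases h with ⟨h1, h2⟩ | ⟨h1, h2, h3⟩ | ⟨h1, h2, h3⟩ | ⟨h1, h2, h3⟩
    · left
      refine ⟨?_, x 2, ?_⟩
      · rw [h2]; exact dvd_mul_right _ _
      · rw [he' 2, h2]
    · right; left
      refine ⟨Or.inl h3, x 0, ?_, hbot 0, ?_⟩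
      · rw [he' 0, h0, h3]
      · rw [he' 0]
        apply hcov' 0
        intro j
        fin_cases j
        · simp
        · simp [h0, h1]
        · simp [h0, h2]
    · right; left
      refine ⟨Or.inr h3, x 2, ?_, hbot 2, ?_⟩
      · rw [he' 2, h2, h3]
      · rw [he' 2]
        apply hcov' 2
        intro j
        fin_cases j
        · simp [h0, h2]
        · simp [h1, h2]
        · simp
    · right; right; exact h3

theorem mul_comm_of_sq_eq_one {K : Type*} [Group K] (h : ∀ k : K, k * k = 1) (a b : K) :
    a * b = b * a := by
  have h1 : ∀ k : K, k⁻¹ = k := fun k => inv_eq_of_mul_eq_one_left (h k)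
  rw [← h1 (a * b), mul_inv_rev, h1, h1]

theorem index_normalCore_dvd {G : Type*} [Group G] [Finite G] (T : Subgroup G) :
    T.normalCore.index ∣ T.index.factorial := by
  rw [Subgroup.normalCore_eq_ker, Subgroup.index_ker, Subgroup.index_eq_card, ← Nat.card_perm]
  exact Subgroup.card_subgroup_dvd_card _

/-- In a group of tetrahedral or octahedral type, the elements preserving each of the three axes
form an elementary abelian normal subgroup of index at most `6`. -/
theorem exists_normal_of_orbit_card_six [Finite G] (hp : p.Prime) (hG : IsMoebiusAction p G X)
    (hpG : ¬ p ∣ Nat.card G) {x : X} (hx6 : 6 * Nat.card (stabilizer G x) = Nat.card G)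
    (hxb : stabilizer G x ≠ ⊥)
    (hx : ∀ y, Nat.card (stabilizer G x) ∣ Nat.card (stabilizer G y) → y ∈ orbit G x) :
    ∃ K : Subgroup G, K.Normal ∧ (∀ a ∈ K, ∀ b ∈ K, a * b = b * a) ∧ K.index ≤ 6 := by
  have hE : ∀ y : X, hG.unipotentStabilizer y = ⊥ :=
    hG.unipotentStabilizer_eq_bot_of_not_dvd hp hpG
  have hpow : ∀ (y : X) (g : G), g • y = y → g ≠ 1 → g ^ p ≠ 1 := by
    intro y g hy hg hgp
    have : g ∈ hG.unipotentStabilizer y := ⟨hy, hgp⟩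
    rw [hE, Subgroup.mem_bot] at this
    exact hg this
  -- The stabilizer of y is abelian, so it preserves the two fixed points of any s ≠ 1 in it: the
  -- second one is the antipode of y.
  have hpair : ∀ y : X, stabilizer G y ≠ ⊥ → ∃ y', y' ≠ y ∧ stabilizer G y ≤ stabilizer G y' ∧
      ∀ z, stabilizer G y ≤ stabilizer G z → z = y ∨ z = y' := by
    intro y hy
    obtain ⟨s, hs, hs1⟩ := (Subgroup.bot_or_exists_ne_one (stabilizer G y)).resolve_left hy
    obtain ⟨y', hne, hfix⟩ := hG.exists_other_fixed (hpow y s hs hs1) hs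
    have hsy' : s • y' = y' := by
      have : y' ∈ fixedBy X s := by rw [hfix]; simp
      exact this
    refine ⟨y', hne, ?_, ?_⟩
    · intro h hh
      have hc := hG.mul_comm_of_unipotentStabilizer_eq_bot (hE y) (a := s) (b := h) hs hh
      have h2 : h • y' ∈ fixedBy X s := by
        change s • h • y' = h • y'
        rw [← mul_smul, hc, mul_smul, hsy']
      rw [hfix] at h2
      rcases h2 with h2 | h2
      · exfalso
        apply hne
        have hhy : h • y = y := hh
        rw [← hhy] at h2
        exact smul_left_cancel h h2
      · exact h2
    · intro z hz
      have : z ∈ fixedBy X s := hz hs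
      rw [hfix] at this
      exact this
  set T := Subgroup.normalizer (stabilizer G x : Set G) with hT
  have hTle : stabilizer G x ≤ T := Subgroup.le_normalizer
  have hmemT : ∀ g : G, g ∈ T ↔ stabilizer G (g • x) = stabilizer G x := by
    intro g
    rw [stabilizer_smul_eq_stabilizer_map_conj, hT, Subgroup.mem_normalizer_iff_map_conj_eq]
    rfl
  -- the normalizer is strictly larger than the stabilizer
  obtain ⟨x', hne, hle, -⟩ := hpair x hxb
  have hx'O : x' ∈ orbit G x := hx x' (Subgroup.card_dvd_of_le hle)
  have hstab : stabilizer G x' = stabilizer G x :=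
    (Subgroup.eq_of_le_of_card_ge hle (card_stabilizer_of_mem_orbit hx'O).le).symm
  obtain ⟨t, ht⟩ := hx'O
  simp only at ht
  have htT : t ∈ T := by rw [hmemT, ht, hstab]
  have htn : t ∉ stabilizer G x := fun h => hne (ht ▸ h)
  have hidx : (stabilizer G x).index = 6 := by
    have h1 := (stabilizer G x).card_mul_index
    rw [← hx6, mul_comm 6] at h1
    exact Nat.eq_of_mul_eq_mul_left Nat.card_pos h1
  have hT3 : T.index ≤ 3 := by
    have h1 := Subgroup.relIndex_mul_index hTle
    rw [hidx] at h1
    have h2 : (stabilizer G x).relIndex T ≠ 1 := by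
      rw [Ne, Subgroup.relIndex_eq_one]
      exact fun h => htn (h htT)
    have h3 : (stabilizer G x).relIndex T ≠ 0 := by intro h0; rw [h0] at h1; omega
    have h4 : 2 ≤ (stabilizer G x).relIndex T := by omega
    nlinarith
  refine ⟨T.normalCore, inferInstance, ?_, ?_⟩
  -- An element of the core maps each of the six points to itself or its antipode, so its square
  -- fixes all six. More than two fixed points force the identity.
  · have hsq : ∀ k ∈ T.normalCore, k * k = 1 := by
      intro k hk
      -- `k` preserves every stabilizer in the orbit
      have hk1 : ∀ y ∈ orbit G x, (k * k) • y = y := by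
        rintro _ ⟨g, rfl⟩
        simp only
        have hyb : stabilizer G (g • x) ≠ ⊥ := by
          rw [← Subgroup.one_lt_card_iff_ne_bot, card_stabilizer_smul,
            Subgroup.one_lt_card_iff_ne_bot]
          exact hxb
        have hky : stabilizer G (k • g • x) = stabilizer G (g • x) := by
          have h1 : g⁻¹ * k * g ∈ T := by
            have := hk g⁻¹
            simpa using this
          rw [hmemT] at h1
          have h2 : k • g • x = g • (g⁻¹ * k * g) • x := by
            simp [mul_smul]
          rw [h2, stabilizer_smul_eq_stabilizer_map_conj g ((g⁻¹ * k * g) • x), h1,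
            ← stabilizer_smul_eq_stabilizer_map_conj]
        have hkky : stabilizer G (k • k • g • x) = stabilizer G (g • x) := by
          rw [stabilizer_smul_eq_stabilizer_map_conj k, hky,
            ← stabilizer_smul_eq_stabilizer_map_conj, hky]
        obtain ⟨y', -, -, hy'⟩ := hpair _ hyb
        rw [mul_smul]
        rcases hy' _ hky.ge with h1 | h1
        · rw [h1, h1]
        · rcases hy' _ hkky.ge with h2 | h2
          · exact h2
          · rw [← h1] at h2
            rw [h2]
            exact smul_left_cancel k h2
      have hcard : (orbit G x).ncard = 6 := by
        rw [← index_stabilizer, hidx]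
      by_contra hkk
      have hsub : orbit G x ⊆ fixedBy X (k * k) := fun y hy => hk1 y hy
      have h3 := Set.ncard_le_ncard hsub (hG.finite_fixedBy hkk)
      rw [hcard, hG.ncard_fixedBy _ hkk] at h3
      split_ifs at h3 <;> omega
    intro a ha b hb
    have := mul_comm_of_sq_eq_one (K := T.normalCore)
      (fun k => Subtype.ext (hsq k k.2)) ⟨a, ha⟩ ⟨b, hb⟩
    exact congrArg Subtype.val this
  · have h1 := Nat.le_of_dvd (Nat.factorial_pos _) (index_normalCore_dvd T)
    exact h1.trans ((Nat.factorial_le hT3).trans (by decide))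

end IsMoebiusAction

/-! ### Groups of order divisible by p -/

theorem card_mul_relIndex_of_le {G : Type*} [Group G] {H K : Subgroup G} (h : H ≤ K) :
    Nat.card H * H.relIndex K = Nat.card K := by
  rw [← Subgroup.relIndex_bot_left, ← Subgroup.relIndex_bot_left,
    Subgroup.relIndex_mul_relIndex _ _ _ bot_le h]

namespace IsMoebiusAction

variable {p : ℕ} {G X : Type*} [Group G] [MulAction G X]

theorem eq_of_unipotentStabilizer_le (hG : IsMoebiusAction p G X) {x y : X}
    (hy : hG.unipotentStabilizer y ≠ ⊥)
    (h : hG.unipotentStabilizer y ≤ hG.unipotentStabilizer x) : y = x := by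
  obtain ⟨u, hu, hu1⟩ := (Subgroup.bot_or_exists_ne_one _).resolve_left hy
  exact hG.eq_of_fixed_of_pow_eq_one hu1 hu.2 (h hu).1 hu.1

/-- Fix u ≠ 1 in the unipotent stabilizer E. Elements commuting with u lie in E, so distinct cosets
of E give distinct conjugates of u, all in E and different from 1. The extra point of `Option`
accounts for 1. -/
theorem relIndex_unipotentStabilizer_lt [Finite G] (hG : IsMoebiusAction p G X) {x : X}
    (hx : hG.unipotentStabilizer x ≠ ⊥) :
    (hG.unipotentStabilizer x).relIndex (stabilizer G x) + 1 ≤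
      Nat.card (hG.unipotentStabilizer x) := by
  obtain ⟨u, hu, hu1⟩ := (Subgroup.bot_or_exists_ne_one _).resolve_left hx
  set E := hG.unipotentStabilizer x with hE
  have hmem : ∀ h : stabilizer G x, (h : G) * u * (h : G)⁻¹ ∈ E := by
    intro h
    refine ⟨?_, by rw [conj_pow_eq_one_iff]; exact hu.2⟩
    have h1 : (h : G) • x = x := h.2
    rw [mul_smul, mul_smul, show (h : G)⁻¹ • x = x by rw [inv_smul_eq_iff, h1], hu.1, h1]
  let f : Option (stabilizer G x ⧸ E.subgroupOf (stabilizer G x)) → E := fun o =>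
    o.elim 1 fun c => ⟨_, hmem c.out⟩
  have hf : Function.Injective f := by
    rintro (_ | c) (_ | d) h
    · rfl
    · exfalso
      have := congrArg Subtype.val h
      simp only [f, Option.elim, OneMemClass.coe_one] at this
      rw [eq_comm, mul_inv_eq_one, mul_eq_left] at this
      exact hu1 this
    · exfalso
      have := congrArg Subtype.val h
      simp only [f, Option.elim, OneMemClass.coe_one] at this
      rw [mul_inv_eq_one, mul_eq_left] at this
      exact hu1 this
    · have := congrArg Subtype.val h
      simp only [f, Option.elim] at this
      congr 1
      rw [← c.out_eq', ← d.out_eq']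
      apply QuotientGroup.eq.mpr
      rw [Subgroup.mem_subgroupOf]
      apply hG.of_commute hu1 hu.2 hu.1
      push_cast
      rw [mul_inv_eq_iff_eq_mul] at this
      calc ((c.out : G))⁻¹ * d.out * u
          = (c.out : G)⁻¹ * (d.out * u * (d.out : G)⁻¹ * c.out) * ((c.out : G)⁻¹ * d.out) := by
            group
        _ = u * ((c.out : G)⁻¹ * d.out) := by rw [← this]; group
  have := Nat.card_le_card_of_injective f hf
  rwa [Finite.card_option] at this

/-- The unipotent stabilizer of x acts freely on the rest of the orbit, since its nontrivial
elements fix only x. -/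
theorem exists_card_orbit_eq [Finite G] (hG : IsMoebiusAction p G X) (x : X) :
    ∃ t, Nat.card (orbit G x) = 1 + Nat.card (hG.unipotentStabilizer x) * t := by
  set E := hG.unipotentStabilizer x with hE
  let Y : SubMulAction E X :=
    { carrier := {y | y ∈ orbit G x ∧ y ≠ x}
      smul_mem' := by
        rintro u y ⟨⟨g, hg⟩, hne⟩
        refine ⟨⟨(u : G) * g, ?_⟩, ?_⟩
        · simp only [mul_smul]
          rw [show g • x = y from hg]; rfl
        · intro h
          apply hne
          have h2 : (u : G) • y = (u : G) • x := by rw [u.2.1]; exact h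
          exact smul_left_cancel _ h2 }
  have hfree : ∀ y : Y, stabilizer E y = ⊥ := by
    intro y
    rw [eq_bot_iff]
    intro u hu
    rw [Subgroup.mem_bot]
    by_contra hu1
    have h1 : (u : G) ≠ 1 := by simpa using hu1
    have h2 : (u : G) • (y : X) = y := congrArg Subtype.val (show u • y = y from hu)
    exact y.2.2 (hG.eq_of_fixed_of_pow_eq_one h1 u.2.2 u.2.1 h2)
  have hcard := Nat.card_congr (selfEquivOrbitsQuotientProd hfree)
  rw [Nat.card_prod] at hcard
  refine ⟨Nat.card (Quotient (orbitRel E Y)), ?_⟩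
  · have horb : (orbit G x) = insert x (Y : Set X) := by
      ext y
      constructor
      · intro hy
        by_cases h : y = x
        · exact Or.inl h
        · exact Or.inr ⟨hy, h⟩
      · rintro (rfl | h)
        · exact mem_orbit_self _
        · exact h.1
    have hYfin : (Y : Set X).Finite := (Set.finite_range fun g : G => g • x).subset fun y hy => hy.1
    rw [Nat.card_coe_set_eq, horb, Set.ncard_insert_of_notMem (fun h => h.2 rfl) hYfin,
      ← Nat.card_coe_set_eq, add_comm]
    congr 1
    rw [mul_comm]
    exact hcard

theorem wild_arith_zero {q m t : ℕ} (hq : 2 ≤ q) (hm : 1 ≤ m)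
    (h : 1 + ((q : ℚ) - 2) / (q * m : ℕ) = 2 - 2 / (q * m * (1 + q * t) : ℕ)) : m = 1 ∧ t = 0 := by
  obtain ⟨r, rfl⟩ : ∃ r, q = r + 2 := ⟨q - 2, by omega⟩
  obtain ⟨k, rfl⟩ : ∃ k, m = k + 1 := ⟨m - 1, by omega⟩
  push_cast at h
  have hs : (0 : ℚ) < 1 + (r + 2) * t := by positivity
  field_simp at h
  have h2 : ((1 + (r + 2) * t) * ((r + 2) * k + 2) : ℚ) = 2 := by linarith
  have h3 : (1 + (r + 2) * t) * ((r + 2) * k + 2) = 2 := by exact_mod_cast h2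
  have h4 : t = 0 := by
    by_contra ht
    have : 1 ≤ t := by omega
    nlinarith [Nat.zero_le ((r + 2) * k), Nat.mul_le_mul_left (r + 2) this, Nat.zero_le r,
      Nat.zero_le ((r + 2) * t * ((r + 2) * k))]
  subst h4
  have h5 : (r + 2) * k = 0 := by rw [mul_zero, add_zero, one_mul] at h3; omega
  have h6 : k = 0 := by
    rcases Nat.mul_eq_zero.mp h5 with h | h
    · omega
    · exact h
  simp [h6]

theorem wild_arith_one {q m t a : ℕ} (hq : 2 ≤ q) (hm : 1 ≤ m) (ha : 1 ≤ a)
    (h : (1 + ((q : ℚ) - 2) / (q * m : ℕ)) + (1 + (((1 : ℕ) : ℚ) - 2) / a) =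
      2 - 2 / (q * m * (1 + q * t) : ℕ)) :
    a * (1 + t * (q - 2)) = m * (1 + q * t) := by
  obtain ⟨r, rfl⟩ : ∃ r, q = r + 2 := ⟨q - 2, by omega⟩
  have hm0 : (0 : ℚ) < m := by exact_mod_cast hm
  have ha0 : (0 : ℚ) < a := by exact_mod_cast ha
  push_cast at h
  have hs : (0 : ℚ) < 1 + (r + 2) * t := by positivity
  field_simp at h
  rw [Nat.add_sub_cancel]
  have h2 : ((r + 2 : ℚ)) * (a * (1 + t * r)) = (r + 2) * (m * (1 + (r + 2) * t)) := by linarith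
  have h3 := mul_left_cancel₀ (by positivity) h2
  exact_mod_cast h3

/-- With r = q - 2, the right side is m(1 + tr) + 2mt. As 1 + tr is coprime to t, it divides 2m ≤ 2r
+ 2. For t ≥ 2 the quotient must be 1, whence t ≤ 3; parity excludes t = 2. -/
theorem wild_arith {q m t a : ℕ} (hq : 3 ≤ q) (hm : 1 ≤ m) (hmq : m + 1 ≤ q)
    (h : a * (1 + t * (q - 2)) = m * (1 + q * t)) :
    t = 0 ∨ (t = 1 ∧ (q - 1) ∣ 2 * m) ∨ (q = 3 ∧ t = 3 ∧ m = 2) := by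
  obtain ⟨r, rfl⟩ : ∃ r, q = r + 2 := ⟨q - 2, by omega⟩
  rw [Nat.add_sub_cancel] at h
  rcases Nat.eq_zero_or_pos t with h0 | ht
  · exact Or.inl h0
  right
  have hdvd : 1 + t * r ∣ 2 * m := by
    have h1 : 1 + t * r ∣ t * (2 * m) := by
      have h2 : 1 + t * r ∣ m * (1 + t * r) + t * (2 * m) := ⟨a, by
        rw [mul_comm _ a, h]; ring⟩
      exact (Nat.dvd_add_right (dvd_mul_left _ _)).mp h2
    have hc : Nat.Coprime (1 + t * r) t := by
      rw [Nat.coprime_add_mul_left_left]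
      exact Nat.coprime_one_left t
    exact hc.dvd_of_dvd_mul_left h1
  obtain ⟨d, hd⟩ := hdvd
  rcases Nat.lt_or_ge 1 t with ht2 | ht1
  · right
    have hd1 : d = 1 := by
      have hd0 : d ≠ 0 := by rintro rfl; omega
      by_contra hne
      have : 2 ≤ d := by omega
      have h3 : (1 + t * r) * 2 ≤ (1 + t * r) * d := Nat.mul_le_mul_left _ this
      nlinarith
    subst hd1
    have ht3 : t ≤ 3 := by
      by_contra hne
      have : 4 * r ≤ t * r := Nat.mul_le_mul_right _ (by omega)
      omega
    interval_cases t <;> omega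
  · left
    have : t = 1 := by omega
    subst this
    exact ⟨rfl, ⟨d, by rw [hd]; congr 1; omega⟩⟩

variable [Fact p.Prime]

theorem pow_eq_one_of_isPGroup [Finite G] (hG : IsMoebiusAction p G X) {P : Subgroup G}
    (hP : IsPGroup p P) {u : G} (hu : u ∈ P) : u ^ p = 1 := by
  by_contra h
  have h1 := hG.not_dvd_orderOf Fact.out h
  obtain ⟨k, hk⟩ := hP ⟨u, hu⟩
  have hk' : u ^ p ^ k = 1 := by simpa using congrArg Subtype.val hk
  obtain ⟨j, -, hj⟩ := (Nat.dvd_prime_pow (Fact.out : p.Prime)).mp (orderOf_dvd_of_pow_eq_one hk')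
  rcases Nat.eq_zero_or_pos j with rfl | hj0
  · rw [pow_zero, orderOf_eq_one_iff] at hj
    rw [hj, one_pow] at h
    exact h rfl
  · exact h1 (hj ▸ dvd_pow_self p hj0.ne')

/-- A central element z ≠ 1 of P is unipotent, and everything commuting with z is unipotent and
fixes its fixed point. -/
theorem exists_le_unipotentStabilizer [Finite G] (hG : IsMoebiusAction p G X) {P : Subgroup G}
    (hP : IsPGroup p P) (hbot : P ≠ ⊥) : ∃ x, P ≤ hG.unipotentStabilizer x := by
  have : Nontrivial P := (Subgroup.nontrivial_iff_ne_bot P).mpr hbot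
  have hc := hP.center_nontrivial
  obtain ⟨z, hz⟩ := exists_ne (1 : Subgroup.center P)
  have hz1 : ((z : P) : G) ≠ 1 := fun h => hz (Subtype.ext (Subtype.ext h))
  have hzp := hG.pow_eq_one_of_isPGroup hP (z : P).2
  obtain ⟨x, hx⟩ := hG.exists_fixed hz1
  refine ⟨x, fun u hu => ?_⟩
  refine hG.of_commute hz1 hzp hx ?_
  have := Subgroup.mem_center_iff.mp z.2 ⟨u, hu⟩
  exact congrArg Subtype.val this

theorem sylow_ne_bot [Finite G] (hpG : p ∣ Nat.card G) (P : Sylow p G) : (P : Subgroup G) ≠ ⊥ :=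
  P.ne_bot_of_dvd_card hpG

theorem exists_sylow_eq [Finite G] (hG : IsMoebiusAction p G X) (hpG : p ∣ Nat.card G)
    (P : Sylow p G) : ∃ x, (P : Subgroup G) = hG.unipotentStabilizer x := by
  obtain ⟨x, hx⟩ := hG.exists_le_unipotentStabilizer P.2 (sylow_ne_bot hpG P)
  exact ⟨x, (P.3 (hG.isPGroup_unipotentStabilizer x) hx).symm⟩

theorem mem_orbit_of_unipotentStabilizer_ne_bot [Finite G] (hG : IsMoebiusAction p G X)
    {P : Sylow p G} {x y : X} (hx : (P : Subgroup G) = hG.unipotentStabilizer x)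
    (hy : hG.unipotentStabilizer y ≠ ⊥) : y ∈ orbit G x := by
  obtain ⟨Q, hQ⟩ := (hG.isPGroup_unipotentStabilizer y).exists_le_sylow
  obtain ⟨g, rfl⟩ := exists_smul_eq G P Q
  refine ⟨g, (hG.eq_of_unipotentStabilizer_le hy (hQ.trans ?_)).symm⟩
  rw [hG.unipotentStabilizer_smul, ← hx]
  exact le_of_eq rfl

/-- The structure of a finite group with elements of order `p`: up to conjugation there is one
wildly ramified point `x`, and at most one further orbit with nontrivial stabilizers. -/
theorem wild_data [Finite G] (hG : IsMoebiusAction p G X) (hpG : p ∣ Nat.card G) :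
    ∃ (x : X) (q m t : ℕ), q = p ^ (Nat.card G).factorization p ∧
      Nat.card (hG.unipotentStabilizer x) = q ∧ Nat.card (stabilizer G x) = q * m ∧
      2 ≤ q ∧ 1 ≤ m ∧ m + 1 ≤ q ∧ Nat.card G = q * m * (1 + q * t) ∧
      ((m = 1 ∧ t = 0) ∨ ∃ y, hG.unipotentStabilizer y = ⊥ ∧
        Nat.card (stabilizer G y) * (1 + t * (q - 2)) = m * (1 + q * t)) := by
  obtain ⟨P⟩ : Nonempty (Sylow p G) := inferInstance
  obtain ⟨x, hx⟩ := hG.exists_sylow_eq hpG P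
  have hbot : hG.unipotentStabilizer x ≠ ⊥ := hx ▸ sylow_ne_bot hpG P
  obtain ⟨t, ht⟩ := hG.exists_card_orbit_eq x
  have hlt := hG.relIndex_unipotentStabilizer_lt hbot
  have hmul := card_mul_relIndex_of_le (hG.unipotentStabilizer_le x)
  have hq : Nat.card (hG.unipotentStabilizer x) = p ^ (Nat.card G).factorization p := by
    rw [← hx]; exact P.card_eq_multiplicity
  set q := Nat.card (hG.unipotentStabilizer x) with hqdef
  set m := (hG.unipotentStabilizer x).relIndex (stabilizer G x) with hmdef
  have hm : 1 ≤ m := by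
    rcases Nat.eq_zero_or_pos m with h | h
    · rw [h, mul_zero] at hmul
      exact absurd hmul.symm Nat.card_pos.ne'
    · exact h
  have hos : Nat.card (orbit G x) * Nat.card (stabilizer G x) = Nat.card G := by
    rw [← Nat.card_prod]
    exact Nat.card_congr (orbitProdStabilizerEquivGroup G x)
  have hcard : Nat.card G = q * m * (1 + q * t) := by rw [← hos, ht, ← hmul, mul_comm]
  refine ⟨x, q, m, t, hq, rfl, hmul.symm, by omega, hm, hlt, hcard, ?_⟩
  obtain ⟨n, z, hzbot, hcov, hinj, -, hsum⟩ := hG.exists_orbit_representatives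
  have hxs : stabilizer G x ≠ ⊥ := fun h =>
    hbot (eq_bot_iff.mpr (h ▸ hG.unipotentStabilizer_le x))
  obtain ⟨i, hi⟩ := hcov x hxs
  have he2 : ∀ i, 2 ≤ Nat.card (stabilizer G (z i)) := fun i => two_le_card_of_ne_bot (hzbot i)
  have hci : Nat.card (stabilizer G (z i)) = q * m := by
    rw [hmul, card_stabilizer_of_mem_orbit hi]
  have hqi : Nat.card (hG.unipotentStabilizer (z i)) = q := by
    obtain ⟨g, rfl⟩ := hi
    exact (hG.card_unipotentStabilizer_smul g (z i)).symm
  have hqj : ∀ j, j ≠ i → hG.unipotentStabilizer (z j) = ⊥ := by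
    intro j hj
    by_contra hne
    have h1 := hG.mem_orbit_of_unipotentStabilizer_ne_bot hx hne
    apply hj
    apply hinj
    rw [← orbit_eq_iff.mpr hi]
    exact h1
  rw [← Finset.add_sum_erase _ _ (Finset.mem_univ i), hci, hqi] at hsum
  have hgpos : (0 : ℚ) < 2 / Nat.card G := by
    have : 0 < Nat.card G := Nat.card_pos
    positivity
  have hq2 : (2 : ℚ) ≤ q := by exact_mod_cast (by omega : 2 ≤ q)
  -- The wild orbit contributes at least 1 because q ≥ 2, every other orbit at least 1/2, and the
  -- total is below 2.
  have hle1 : (Finset.univ.erase i).card ≤ 1 := by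
    have h1 : ∀ j ∈ Finset.univ.erase i, (1 / 2 : ℚ) ≤
        1 + ((Nat.card (hG.unipotentStabilizer (z j)) : ℚ) - 2) / Nat.card (stabilizer G (z j)) := by
      intro j hj
      rw [hqj j (Finset.ne_of_mem_erase hj), Subgroup.card_bot]
      have : (2 : ℚ) ≤ Nat.card (stabilizer G (z j)) := by exact_mod_cast he2 j
      rw [← sub_nonneg]
      have h3 : (1 + (((1 : ℕ) : ℚ) - 2) / Nat.card (stabilizer G (z j))) - 1 / 2 =
          (Nat.card (stabilizer G (z j)) - 2) / (2 * Nat.card (stabilizer G (z j))) := by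
        field_simp; push_cast; ring
      rw [h3]
      apply div_nonneg <;> linarith
    have h2 := Finset.card_nsmul_le_sum _ _ _ h1
    rw [nsmul_eq_mul] at h2
    have h3 : (0 : ℚ) ≤ ((q : ℚ) - 2) / (q * m : ℕ) := div_nonneg (by linarith) (by positivity)
    have h4 : ((Finset.univ.erase i).card : ℚ) < 2 := by linarith
    have h5 : (Finset.univ.erase i).card < 2 := by exact_mod_cast h4
    omega
  rw [hcard] at hsum
  rcases Nat.lt_or_ge 0 (Finset.univ.erase i).card with h0 | h0
  · right
    obtain ⟨j, hj⟩ := Finset.card_eq_one.mp (le_antisymm hle1 h0)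
    have hji : j ≠ i := by
      have : j ∈ Finset.univ.erase i := by rw [hj]; simp
      exact Finset.ne_of_mem_erase this
    rw [hj, Finset.sum_singleton, hqj j hji, Subgroup.card_bot] at hsum
    exact ⟨z j, hqj j hji, wild_arith_one (by omega) hm (by have := he2 j; omega) hsum⟩
  · left
    have : Finset.univ.erase i = ∅ := Finset.card_eq_zero.mp (by omega)
    rw [this, Finset.sum_empty, add_zero] at hsum
    exact wild_arith_zero (by omega) hm hsum

theorem wild_cases [Finite G] (hG : IsMoebiusAction p G X) (hpG : p ∣ Nat.card G) {q : ℕ}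
    (hq : q = p ^ (Nat.card G).factorization p) :
    (q = 2 ∧ (Nat.card G = 2 ∨ ∃ y : X, hG.unipotentStabilizer y = ⊥ ∧
      2 * Nat.card (stabilizer G y) = Nat.card G)) ∨
    (3 ≤ q ∧ Nat.card G ≤ q ^ 3) ∨ (q = 3 ∧ Nat.card G = 60) := by
  obtain ⟨x, q', m, t, hq', -, -, h2, hm, hmq, hcard, h⟩ := hG.wild_data hpG
  obtain rfl : q' = q := hq'.trans hq.symm
  rcases Nat.lt_or_ge 2 q' with h3 | h3
  · right
    -- Since m ≤ q - 1, the order qm(1 + qt) is at most q(q - 1)(q + 1).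
    have hbound : t ≤ 1 → Nat.card G ≤ q' ^ 3 := by
      intro ht
      obtain ⟨r, rfl⟩ : ∃ r, q' = r + 1 := ⟨q' - 1, by omega⟩
      have hmr : m ≤ r := by omega
      calc Nat.card G = (r + 1) * m * (1 + (r + 1) * t) := hcard
        _ ≤ (r + 1) * r * (1 + (r + 1) * 1) := by gcongr
        _ ≤ (r + 1) ^ 3 := by nlinarith
    rcases h with ⟨-, ht⟩ | ⟨y, -, hy⟩
    · exact Or.inl ⟨h3, hbound (by omega)⟩
    · rcases wild_arith h3 hm hmq hy with ht | ⟨ht, -⟩ | ⟨hq3, ht, hm2⟩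
      · exact Or.inl ⟨h3, hbound (by omega)⟩
      · exact Or.inl ⟨h3, hbound (by omega)⟩
      · exact Or.inr ⟨hq3, by rw [hcard, hq3, ht, hm2]⟩
  · left
    obtain rfl : q' = 2 := by omega
    obtain rfl : m = 1 := by omega
    refine ⟨rfl, ?_⟩
    rcases h with ⟨-, ht⟩ | ⟨y, hy1, hy⟩
    · left; rw [hcard, ht]
    · right
      refine ⟨y, hy1, ?_⟩
      rw [Nat.sub_self, mul_zero, add_zero, mul_one, one_mul] at hy
      rw [hcard, hy, mul_one]

/-- The hypothesis means m = 1. Then t = 1 requires q - 1 to divide 2, so q = 3 and the order is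
3·4. -/
theorem wild_cases_of_stabilizer_le [Finite G] (hG : IsMoebiusAction p G X)
    (hpG : p ∣ Nat.card G) {q : ℕ} (hq : q = p ^ (Nat.card G).factorization p) (hq3 : 3 ≤ q)
    (hst : ∀ x, Nat.card (hG.unipotentStabilizer x) = q → stabilizer G x ≤ hG.unipotentStabilizer x) :
    Nat.card G = q ∨ (q = 3 ∧ Nat.card G = 12) := by
  obtain ⟨x, q', m, t, hq', hE, hS, h2, hm, hmq, hcard, h⟩ := hG.wild_data hpG
  obtain rfl : q' = q := hq'.trans hq.symm
  have hm1 : m = 1 := by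
    have := Subgroup.card_le_of_le (hst x hE)
    rw [hE, hS] at this
    nlinarith
  subst hm1
  rcases h with ⟨-, ht⟩ | ⟨y, -, hy⟩
  · left; rw [hcard, ht]; simp
  · rcases wild_arith hq3 hm hmq hy with ht | ⟨ht, hd⟩ | ⟨-, -, hm2⟩
    · left; rw [hcard, ht]; simp
    · right
      have := Nat.le_of_dvd (by omega) hd
      have : q' = 3 := by omega
      exact ⟨this, by rw [hcard, ht, this]⟩
    · omega

end IsMoebiusAction

/-! ### Constants and auxiliary group theory -/

/-- The constant in the Jordan bound for a single factor, scaled by `27`. -/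
def pglTwoConst (p : ℕ) : ℕ :=
  -- Divided by 27 these are 60, for groups of order 60 with trivial N; 6, for the tetrahedral and
  -- octahedral types; 60/27, so that order 60 with q = 3 satisfies 60 ≤ (60/27)·3³; and 1.
  if 7 ≤ p then 1620 else if p = 5 then 162 else if p = 3 then 60 else 27

theorem le_pglTwoConst (p : ℕ) : 27 ≤ pglTwoConst p := by
  unfold pglTwoConst
  split_ifs <;> omega

theorem le_pglTwoConst_of_ne_two {p : ℕ} (hp : p.Prime) (h2 : p ≠ 2) : 60 ≤ pglTwoConst p := by
  have h0 := hp.two_le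
  have h4 : p ≠ 4 := by rintro rfl; exact absurd hp (by decide)
  have h6 : p ≠ 6 := by rintro rfl; exact absurd hp (by decide)
  unfold pglTwoConst
  split_ifs <;> omega

theorem le_pglTwoConst_of_five_le {p : ℕ} (hp : p.Prime) (h2 : p ≠ 2) (h3 : p ≠ 3) :
    162 ≤ pglTwoConst p := by
  have h0 := hp.two_le
  have h4 : p ≠ 4 := by rintro rfl; exact absurd hp (by decide)
  have h6 : p ≠ 6 := by rintro rfl; exact absurd hp (by decide)
  unfold pglTwoConst
  split_ifs <;> omega

theorem le_pglTwoConst_of_seven_le {p : ℕ} (hp : p.Prime) (h2 : p ≠ 2) (h3 : p ≠ 3)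
    (h5 : p ≠ 5) : 1620 ≤ pglTwoConst p := by
  have h0 := hp.two_le
  have h4 : p ≠ 4 := by rintro rfl; exact absurd hp (by decide)
  have h6 : p ≠ 6 := by rintro rfl; exact absurd hp (by decide)
  unfold pglTwoConst
  split_ifs <;> omega

theorem mem_of_index_two_of_odd {G : Type*} [Group G] {C : Subgroup G} (hC : C.index = 2) {b : G}
    (hb : Odd (orderOf b)) : b ∈ C := by
  obtain ⟨j, hj⟩ := hb
  have h1 : b = (b * b) ^ (j + 1) := by
    rw [← pow_two, ← pow_mul, show 2 * (j + 1) = orderOf b + 1 by omega, pow_succ,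
      pow_orderOf_eq_one, one_mul]
  rw [h1]
  exact C.pow_mem (Subgroup.mul_self_mem_of_index_two hC b) _

/-- The product of two normal subgroups of order prime to p again has order prime to p, so a maximal
one is the largest. -/
theorem exists_max_normal_not_dvd {G : Type*} [Group G] [Finite G] {p : ℕ} (hp : p.Prime) :
    ∃ N : Subgroup G, N.Normal ∧ ¬ p ∣ Nat.card N ∧
      ∀ C : Subgroup G, C.Normal → ¬ p ∣ Nat.card C → C ≤ N := by
  have hfin : {N : Subgroup G | N.Normal ∧ ¬ p ∣ Nat.card N}.Finite := Set.toFinite _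
  have hne : {N : Subgroup G | N.Normal ∧ ¬ p ∣ Nat.card N}.Nonempty :=
    ⟨⊥, inferInstance, by simpa using hp.one_lt.ne'⟩
  obtain ⟨N, hN, hmax⟩ := hfin.exists_maximal hne
  refine ⟨N, hN.1, hN.2, fun C hC hCp => ?_⟩
  have := hN.1
  have hsup : N ⊔ C ∈ {N : Subgroup G | N.Normal ∧ ¬ p ∣ Nat.card N} := by
    refine ⟨Subgroup.sup_normal N C, fun hd => ?_⟩
    rw [← card_mul_relIndex_of_le (le_sup_left : N ≤ N ⊔ C),
      Subgroup.relIndex_sup_left] at hd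
    rcases hp.dvd_mul.mp hd with h | h
    · exact hN.2 h
    · exact hCp (h.trans (Subgroup.relIndex_dvd_card _ _))
  exact le_sup_right.trans (hmax hsup le_sup_left)

theorem ordProj_eq_one {p n : ℕ} (h : ¬ p ∣ n) : p ^ n.factorization p = 1 := by
  rw [Nat.factorization_eq_zero_of_not_dvd h, pow_zero]

/-! ### The Jordan subgroup for one factor -/

namespace IsMoebiusAction

variable {p : ℕ} [Fact p.Prime] {G X : Type*} [Group G] [MulAction G X]

theorem not_dvd_card_stabilizer [Finite G] (hG : IsMoebiusAction p G X) {y : X}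
    (hy : hG.unipotentStabilizer y = ⊥) : ¬ p ∣ Nat.card (stabilizer G y) := by
  intro h
  obtain ⟨u, hu⟩ := exists_prime_orderOf_dvd_card' p h
  have h1 : (u : G) ∈ hG.unipotentStabilizer y := by
    refine ⟨u.2, ?_⟩
    rw [← hu, ← Subgroup.orderOf_coe]
    exact pow_orderOf_eq_one _
  rw [hy, Subgroup.mem_bot] at h1
  have h2 : u = 1 := Subtype.ext h1
  rw [h2, orderOf_one] at hu
  exact (Fact.out : p.Prime).one_lt.ne hu

/-- The prime p differs from the prime divisors of |G|: index two occurs only for p ≠ 2, index up to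
six only for p ≥ 5, and order 60 only for p ≥ 7. This matches the constants. -/
theorem exists_normal_of_not_dvd [Finite G] (hG : IsMoebiusAction p G X)
    (hpG : ¬ p ∣ Nat.card G) :
    ∃ N : Subgroup G, N.Normal ∧ (∀ a ∈ N, ∀ b ∈ N, a * b = b * a) ∧
      27 * N.index ≤ pglTwoConst p := by
  have hp : p.Prime := Fact.out
  have hE : ∀ y : X, hG.unipotentStabilizer y = ⊥ :=
    hG.unipotentStabilizer_eq_bot_of_not_dvd hp hpG
  have hne : ∀ r, r ∣ Nat.card G → p ≠ r := fun r hr h => hpG (h ▸ hr)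
  rcases hG.tame_cases hp hpG with h | ⟨x, hx⟩ | ⟨h2, x, hx⟩ | ⟨hg, x, hx6, hxb, hx⟩ | hg
  · have : Subsingleton G := (Nat.card_eq_one_iff_unique.mp h).1
    exact ⟨⊤, inferInstance, fun a _ b _ => Subsingleton.elim _ _, by
      simpa using le_pglTwoConst p⟩
  · refine ⟨⊤, inferInstance, fun a _ b _ => ?_, by simpa using le_pglTwoConst p⟩
    have hmem : ∀ a : G, a • x = x := fun a => by
      have : a ∈ stabilizer G x := hx ▸ Subgroup.mem_top a
      exact this
    exact hG.mul_comm_of_unipotentStabilizer_eq_bot (hE x) (hmem a) (hmem b)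
  · have hidx : (stabilizer G x).index = 2 := by
      have h1 := (stabilizer G x).card_mul_index
      rw [← hx, mul_comm 2] at h1
      exact Nat.eq_of_mul_eq_mul_left Nat.card_pos h1
    refine ⟨stabilizer G x, Subgroup.normal_of_index_eq_two hidx, fun a ha b hb =>
      hG.mul_comm_of_unipotentStabilizer_eq_bot (hE x) ha hb, ?_⟩
    rw [hidx]
    have := le_pglTwoConst_of_ne_two hp (hne 2 h2)
    omega
  · obtain ⟨K, hK, hKc, hK6⟩ := hG.exists_normal_of_orbit_card_six hp hpG hx6 hxb hx
    refine ⟨K, hK, hKc, ?_⟩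
    have := le_pglTwoConst_of_five_le hp (hne 2 (by rcases hg with h | h <;> rw [h] <;> decide))
      (hne 3 (by rcases hg with h | h <;> rw [h] <;> decide))
    omega
  · refine ⟨⊥, inferInstance, ?_, ?_⟩
    · intro a ha b hb
      rw [Subgroup.mem_bot.mp ha, Subgroup.mem_bot.mp hb]
    · rw [Subgroup.index_bot, hg]
      exact le_pglTwoConst_of_seven_le hp (hne 2 (by rw [hg]; decide)) (hne 3 (by rw [hg]; decide))
        (hne 5 (by rw [hg]; decide))

theorem exists_index_two [Finite G] (hG : IsMoebiusAction p G X) (hpG : p ∣ Nat.card G)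
    (hq : p ^ (Nat.card G).factorization p = 2) :
    p = 2 ∧ ∃ C : Subgroup G, C.index = 2 ∧ ¬ p ∣ Nat.card C ∧
      ∀ a ∈ C, ∀ b ∈ C, a * b = b * a := by
  have hp : p.Prime := Fact.out
  have hp2 : p = 2 := by
    have h1 : p ∣ 2 := by
      rw [← hq]
      exact dvd_pow_self p (hp.factorization_pos_of_dvd Nat.card_pos.ne' hpG).ne'
    exact (Nat.prime_dvd_prime_iff_eq hp Nat.prime_two).mp h1
  refine ⟨hp2, ?_⟩
  rcases hG.wild_cases hpG rfl with ⟨-, h | ⟨y, hy, hy2⟩⟩ | ⟨h, -⟩ | ⟨h, -⟩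
  · refine ⟨⊥, by rw [Subgroup.index_bot, h], by simpa using hp.one_lt.ne', ?_⟩
    intro a ha b hb
    rw [Subgroup.mem_bot.mp ha, Subgroup.mem_bot.mp hb]
  · refine ⟨stabilizer G y, ?_, hG.not_dvd_card_stabilizer hy, fun a ha b hb =>
      hG.mul_comm_of_unipotentStabilizer_eq_bot hy ha hb⟩
    have h1 := (stabilizer G y).card_mul_index
    rw [← hy2, mul_comm 2] at h1
    exact Nat.eq_of_mul_eq_mul_left Nat.card_pos h1
  · omega
  · omega

/-- Let E be a unipotent stabilizer of order q at x, and u ≠ 1 in E. If k = ne fixes x, with n in N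
and e in E, then so does n. The commutator of n and u lies in N and has p-th power 1, hence is
trivial; so n commutes with u and is unipotent. Thus the whole stabilizer is unipotent. -/
theorem card_of_normal_complement [Finite G] (hG : IsMoebiusAction p G X) {q : ℕ} (hq3 : 3 ≤ q)
    {N : Subgroup G} [N.Normal] (hN : ¬ p ∣ Nat.card N) (hcard : Nat.card N * q = Nat.card G)
    (hq : q = p ^ (Nat.card G).factorization p) (hpG : p ∣ Nat.card G) :
    Nat.card N = 1 ∨ Nat.card N = 4 := by
  have hp : p.Prime := Fact.out
  have hst : ∀ x, Nat.card (hG.unipotentStabilizer x) = q →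
      stabilizer G x ≤ hG.unipotentStabilizer x := by
    intro x hx k hk
    have hcop : Nat.Coprime (Nat.card N) (Nat.card (hG.unipotentStabilizer x)) := by
      rw [hx, hq]
      exact ((hp.coprime_iff_not_dvd.mpr hN).symm).pow_right _
    have hcompl := Subgroup.isComplement'_of_coprime (H := N) (K := hG.unipotentStabilizer x)
      (by rw [hx, hcard]) hcop
    obtain ⟨⟨n, e⟩, hne⟩ := hcompl.surjective k
    simp only at hne
    have hbot : hG.unipotentStabilizer x ≠ ⊥ := by
      intro hb
      rw [hb, Subgroup.card_bot] at hx
      omega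
    obtain ⟨u, hu, hu1⟩ := (Subgroup.bot_or_exists_ne_one _).resolve_left hbot
    have hnx : (n : G) • x = x := by
      have h1 : k • x = x := hk
      rw [← hne, mul_smul, e.2.1] at h1
      exact h1
    have hcomm : (n : G) * u * (n : G)⁻¹ * u⁻¹ = 1 := by
      have h1 : (n : G) * u * (n : G)⁻¹ * u⁻¹ ∈ N := by
        have := Subgroup.Normal.conj_mem (inferInstance : N.Normal) _ (N.inv_mem n.2) u
        simpa [mul_assoc] using N.mul_mem n.2 this
      have h2 := hG.commutator_pow_eq_one x _ _ hnx hu.1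
      by_contra h3
      rcases (Nat.dvd_prime hp).mp (orderOf_dvd_of_pow_eq_one h2) with h4 | h4
      · exact h3 (orderOf_eq_one_iff.mp h4)
      · exact hN (h4 ▸ Subgroup.orderOf_dvd_natCard N h1)
    have hnp : (n : G) ^ p = 1 := by
      apply (hG.of_commute hu1 hu.2 hu.1 _).2
      rwa [mul_inv_eq_one, mul_inv_eq_iff_eq_mul] at hcomm
    rw [← hne]
    exact (hG.unipotentStabilizer x).mul_mem ⟨hnx, hnp⟩ e.2
  rcases hG.wild_cases_of_stabilizer_le hpG hq hq3 hst with h | ⟨h1, h2⟩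
  · left
    rw [← hcard] at h
    exact Nat.eq_of_mul_eq_mul_right (by omega : 0 < q) (by rw [h, one_mul])
  · right
    rw [← hcard, h1] at h2
    omega

/-- For q ≥ 3, applying the previous count to N·P with P a Sylow subgroup gives |N| = 1 or 4 = 2².
For q = 2, N has odd order and lies in an abelian subgroup of index two. -/
theorem comm_of_normal_not_dvd [Finite G] (hG : IsMoebiusAction p G X) (hpG : p ∣ Nat.card G)
    {N : Subgroup G} [N.Normal] (hN : ¬ p ∣ Nat.card N) : ∀ a ∈ N, ∀ b ∈ N, a * b = b * a := by
  have hp : p.Prime := Fact.out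
  set q := p ^ (Nat.card G).factorization p with hq
  have hq2 : 2 ≤ q := hp.two_le.trans (Nat.le_self_pow
    (hp.factorization_pos_of_dvd Nat.card_pos.ne' hpG).ne' p)
  rcases Nat.lt_or_ge 2 q with hq3 | hq3
  · obtain ⟨P⟩ : Nonempty (Sylow p G) := inferInstance
    have hP : Nat.card P = q := P.card_eq_multiplicity
    set K := N ⊔ (P : Subgroup G) with hK
    have hcop : Nat.Coprime (Nat.card N) (Nat.card P) := by
      rw [hP, hq]
      exact ((hp.coprime_iff_not_dvd.mpr hN).symm).pow_right _
    have hKcard : Nat.card N * q = Nat.card K := by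
      rw [← card_mul_relIndex_of_le (le_sup_left : N ≤ K),
        Subgroup.relIndex_sup_left, ← Subgroup.inf_relIndex_right,
        (Subgroup.disjoint_of_coprime_natCard hcop).eq_bot, Subgroup.relIndex_bot_left, hP]
    have hNK : Nat.card (N.subgroupOf K) = Nat.card N :=
      Nat.card_congr (Subgroup.subgroupOfEquivOfLe le_sup_left).toEquiv
    have hqK : q = p ^ (Nat.card K).factorization p := by
      rw [← hKcard, Nat.factorization_mul Nat.card_pos.ne' (by omega), Finsupp.add_apply,
        Nat.factorization_eq_zero_of_not_dvd hN, zero_add, hq, hp.factorization_pow,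
        Finsupp.single_eq_same]
    have hpq : p ∣ q := dvd_pow_self p (hp.factorization_pos_of_dvd Nat.card_pos.ne' hpG).ne'
    have h14 := (hG.subgroup K).card_of_normal_complement hq3 (N := N.subgroupOf K)
      (by rwa [hNK]) (by rw [hNK, hKcard]) hqK (hKcard ▸ dvd_mul_of_dvd_right hpq _)
    rw [hNK] at h14
    intro a ha b hb
    rcases h14 with h | h
    · rw [Subgroup.card_eq_one] at h
      subst h
      rw [Subgroup.mem_bot.mp ha, Subgroup.mem_bot.mp hb]
    · have : Fact (Nat.Prime 2) := ⟨Nat.prime_two⟩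
      have := (IsPGroup.isMulCommutative_of_card_eq_prime_sq (G := N) (p := 2)
        (by rw [h]; norm_num)).is_comm.comm ⟨a, ha⟩ ⟨b, hb⟩
      exact congrArg Subtype.val this
  · obtain ⟨hp2, C, hC, -, hcomm⟩ := hG.exists_index_two hpG (le_antisymm hq3 hq2)
    have hNC : N ≤ C := by
      intro n hn
      apply mem_of_index_two_of_odd hC
      rw [← Nat.not_even_iff_odd, even_iff_two_dvd]
      intro h
      exact hN (hp2 ▸ h.trans (Subgroup.orderOf_dvd_natCard N hn))
    exact fun a ha b hb => hcomm a (hNC ha) b (hNC hb)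

theorem relIndex_le_of_max [Finite G] (hG : IsMoebiusAction p G X) {N : Subgroup G}
    (hN : ∀ C : Subgroup G, C.Normal → ¬ p ∣ Nat.card C → C ≤ N) {B : Subgroup G} (hB : B.Normal) :
    27 * N.relIndex B ≤ pglTwoConst p * (p ^ (Nat.card B).factorization p) ^ 3 := by
  have hp : p.Prime := Fact.out
  have hc := le_pglTwoConst p
  by_cases hpB : p ∣ Nat.card B
  · have hle : N.relIndex B ≤ Nat.card B :=
      Nat.le_of_dvd Nat.card_pos (Subgroup.relIndex_dvd_card _ _)
    rcases (hG.subgroup B).wild_cases hpB rfl with ⟨h2, -⟩ | ⟨-, h⟩ | ⟨h3, h⟩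
    · obtain ⟨hp2, C, hC, hCp, -⟩ := (hG.subgroup B).exists_index_two hpB h2
      have hCcard : Nat.card (C.map B.subtype) = Nat.card C :=
        Subgroup.card_map_of_injective B.subtype_injective
      -- C consists of the elements of B of odd order, so conjugation in G preserves it. Hence C ≤
      -- N, and the relative index is at most 2.
      have hnormal : (C.map B.subtype).Normal := by
        refine ⟨?_⟩
        rintro _ ⟨c, hc, rfl⟩ g
        have hmem : g * c * g⁻¹ ∈ B := hB.conj_mem c c.2 g
        refine ⟨⟨_, hmem⟩, ?_, rfl⟩
        apply mem_of_index_two_of_odd hC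
        rw [← Subgroup.orderOf_coe, ← Nat.not_even_iff_odd, even_iff_two_dvd]
        intro hd
        have h1 : orderOf (g * (c : G) * g⁻¹) = orderOf (c : G) :=
          orderOf_injective (MulAut.conj g).toMonoidHom (MulAut.conj g).injective c
        simp only at hd
        rw [h1, Subgroup.orderOf_coe] at hd
        exact hCp (hp2 ▸ hd.trans (Subgroup.orderOf_dvd_natCard C hc))
      have hCN := hN _ hnormal (by rwa [hCcard])
      have hrel : (C.map B.subtype).relIndex B = 2 := by
        rw [← hC]
        change ((C.map B.subtype).subgroupOf B).index = _
        rw [Subgroup.subgroupOf, Subgroup.comap_map_eq_self_of_injective B.subtype_injective]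
      have hdvd := Subgroup.relIndex_dvd_of_le_left B hCN
      rw [hrel] at hdvd
      have := Nat.le_of_dvd (by norm_num) hdvd
      rw [h2]
      omega
    · calc 27 * N.relIndex B ≤ 27 * (p ^ (Nat.card B).factorization p) ^ 3 := by
            gcongr; exact hle.trans h
        _ ≤ _ := by gcongr
    · have hp3 : p ∣ 3 := by
        rw [← h3]
        exact dvd_pow_self p (hp.factorization_pos_of_dvd Nat.card_pos.ne' hpB).ne'
      have hp3' : p = 3 := (Nat.prime_dvd_prime_iff_eq hp Nat.prime_three).mp hp3
      have hc3 := le_pglTwoConst_of_ne_two hp (by omega)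
      rw [h3]
      omega
  · have h1 : N.relIndex B = 1 := Subgroup.relIndex_eq_one.mpr (hN B hB hpB)
    rw [ordProj_eq_one hpB, h1]
    omega

/-- A finite group acting like a subgroup of `PGL₂` contains a normal abelian subgroup `N` of order
prime to `p` whose index is controlled by a Sylow `p`-subgroup, relative to every normal
subgroup. -/
theorem exists_jordan_subgroup [Finite G] (hG : IsMoebiusAction p G X) :
    ∃ N : Subgroup G, N.Normal ∧ (∀ a ∈ N, ∀ b ∈ N, a * b = b * a) ∧ ¬ p ∣ Nat.card N ∧
      ∀ B : Subgroup G, B.Normal →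
        27 * N.relIndex B ≤ pglTwoConst p * (p ^ (Nat.card B).factorization p) ^ 3 := by
  by_cases hpG : p ∣ Nat.card G
  -- Taking N largest lets one subgroup serve all normal B at once.
  · obtain ⟨N, hN, hNp, hmax⟩ := exists_max_normal_not_dvd (G := G) (Fact.out : p.Prime)
    exact ⟨N, hN, hG.comm_of_normal_not_dvd hpG hNp, hNp, fun B hB =>
      hG.relIndex_le_of_max hmax hB⟩
  · obtain ⟨N, hN, hNc, hidx⟩ := hG.exists_normal_of_not_dvd hpG
    refine ⟨N, hN, hNc, fun h => hpG (h.trans (Subgroup.card_subgroup_dvd_card N)), fun B hB => ?_⟩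
    have hB' : ¬ p ∣ Nat.card B := fun h => hpG (h.trans (Subgroup.card_subgroup_dvd_card B))
    rw [ordProj_eq_one hB', one_pow, mul_one]
    have := Nat.le_of_dvd (Nat.pos_of_ne_zero Subgroup.index_ne_zero_of_finite)
      (Subgroup.relIndex_dvd_index_of_normal N B)
    omega

end IsMoebiusAction

/-! ### Jordan subgroups inside an ambient group and the Goursat-type bound -/

/-- `N` is a normal abelian subgroup of `H` of order prime to `p` whose index, relative to every
normal subgroup of `H`, is controlled by a Sylow `p`-subgroup. -/
structure IsJordanSubgroup (p : ℕ) {Γ : Type*} [Group Γ] (H N : Subgroup Γ) : Prop where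
  le : N ≤ H
  conj_mem : ∀ h ∈ H, ∀ n ∈ N, h * n * h⁻¹ ∈ N
  comm : ∀ a ∈ N, ∀ b ∈ N, a * b = b * a
  not_dvd : ¬ p ∣ Nat.card N
  bound : ∀ B ≤ H, (∀ h ∈ H, ∀ b ∈ B, h * b * h⁻¹ ∈ B) →
    27 * N.relIndex B ≤ pglTwoConst p * (p ^ (Nat.card B).factorization p) ^ 3

theorem IsMoebiusAction.exists_isJordanSubgroup {p : ℕ} [Fact p.Prime] {Γ X : Type*} [Group Γ]
    [MulAction Γ X] (hΓ : IsMoebiusAction p Γ X) (H : Subgroup Γ) [Finite H] :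
    ∃ N, IsJordanSubgroup p H N := by
  obtain ⟨N, hN, hc, hp, hb⟩ := (hΓ.subgroup H).exists_jordan_subgroup
  refine ⟨N.map H.subtype, Subgroup.map_subtype_le N, ?_, ?_, ?_, ?_⟩
  · rintro h hh _ ⟨n, hn, rfl⟩
    exact ⟨⟨h, hh⟩ * n * ⟨h, hh⟩⁻¹, hN.conj_mem n hn _, rfl⟩
  · rintro _ ⟨a, ha, rfl⟩ _ ⟨b, hb, rfl⟩
    exact congrArg Subtype.val (hc a ha b hb)
  · rwa [Subgroup.card_map_of_injective H.subtype_injective]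
  · intro B hBH hBn
    have hB : (B.subgroupOf H).Normal :=
      ⟨fun b hb h => hBn h h.2 b hb⟩
    have h1 := hb _ hB
    rw [← Subgroup.relIndex_map_map_of_injective N (B.subgroupOf H) H.subtype_injective,
      Subgroup.map_subgroupOf_eq_of_le hBH,
      Nat.card_congr (Subgroup.subgroupOfEquivOfLe hBH).toEquiv] at h1
    exact h1

theorem IsJordanSubgroup.map_conj {p : ℕ} {Γ : Type*} [Group Γ] {H N : Subgroup Γ}
    (h : IsJordanSubgroup p H N) (y : Γ) :
    IsJordanSubgroup p (H.map (MulAut.conj y).toMonoidHom) (N.map (MulAut.conj y).toMonoidHom) := by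
  set φ := (MulAut.conj y).toMonoidHom with hφ
  have hinj : Function.Injective φ := (MulAut.conj y).injective
  refine ⟨Subgroup.map_mono h.le, ?_, ?_, ?_, ?_⟩
  · rintro _ ⟨a, ha, rfl⟩ _ ⟨n, hn, rfl⟩
    exact ⟨a * n * a⁻¹, h.conj_mem a ha n hn, by simp only [map_mul, map_inv]⟩
  · rintro _ ⟨a, ha, rfl⟩ _ ⟨b, hb, rfl⟩
    rw [← map_mul, ← map_mul, h.comm a ha b hb]
  · rw [Subgroup.card_map_of_injective hinj]
    exact h.not_dvd
  · intro B hBH hBn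
    obtain ⟨C, rfl⟩ : ∃ C : Subgroup Γ, B = C.map φ :=
      ⟨B.comap φ, (Subgroup.map_comap_eq_self_of_surjective (MulAut.conj y).surjective B).symm⟩
    rw [Subgroup.relIndex_map_map_of_injective N C hinj, Subgroup.card_map_of_injective hinj]
    refine h.bound C ((Subgroup.map_le_map_iff_of_injective hinj).mp hBH) fun a ha b hb => ?_
    have h1 := hBn _ (Subgroup.mem_map_of_mem φ ha) _ (Subgroup.mem_map_of_mem φ hb)
    rw [← map_inv, ← map_mul, ← map_mul] at h1
    exact (Subgroup.mem_map_iff_mem hinj).mp h1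

theorem ordProj_le_of_dvd {p a b : ℕ} (hb : b ≠ 0) (h : a ∣ b) :
    p ^ a.factorization p ≤ p ^ b.factorization p := by
  rcases Nat.eq_zero_or_pos p with rfl | hp
  · simp
  · exact Nat.pow_le_pow_right hp
      ((Nat.factorization_le_iff_dvd (ne_zero_of_dvd_ne_zero hb h) hb).mpr h p)

theorem ordProj_mul_of_not_dvd {p a b : ℕ} (ha : a ≠ 0) (hb : b ≠ 0) (h : ¬ p ∣ a) :
    p ^ (a * b).factorization p = p ^ b.factorization p := by
  rw [Nat.factorization_mul ha hb, Finsupp.add_apply, pow_add, ordProj_eq_one h, one_mul]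

/-- The bound for a finite group with two homomorphisms, in the style of Goursat's lemma. -/
theorem index_comap_inf_comap_le {p : ℕ} [Fact p.Prime] {K Γ : Type*} [Group K] [Finite K] [Group Γ]
    {f₁ f₂ : K →* Γ} {N₁ N₂ : Subgroup Γ} (h₁ : IsJordanSubgroup p f₁.range N₁)
    (h₂ : IsJordanSubgroup p f₂.range N₂) :
    729 * (N₁.comap f₁ ⊓ N₂.comap f₂).index ≤
      pglTwoConst p ^ 2 * (p ^ (Nat.card K).factorization p) ^ 3 := by
  set D := N₁.comap f₁ with hD
  set c := pglTwoConst p with hc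
  have hfin : Finite f₁.range := (Set.finite_range f₁).to_subtype
  have hDn : D.Normal := ⟨fun d hd g => by
    rw [hD, Subgroup.mem_comap, map_mul, map_mul, map_inv]
    exact h₁.conj_mem _ ⟨g, rfl⟩ _ hd⟩
  have hidx : D.index = N₁.relIndex f₁.range := Subgroup.index_comap N₁ f₁
  have hrel : (N₂.comap f₂).relIndex D = N₂.relIndex (D.map f₂) := Subgroup.relIndex_comap N₂ f₂ D
  have hmul : (D ⊓ N₂.comap f₂).index = N₂.relIndex (D.map f₂) * N₁.relIndex f₁.range := by
    rw [← Subgroup.relIndex_mul_index (inf_le_left : D ⊓ N₂.comap f₂ ≤ D),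
      Subgroup.inf_relIndex_left, hrel, hidx]
  have hb1 := h₁.bound f₁.range le_rfl fun a ha b hb =>
    Subgroup.mul_mem _ (Subgroup.mul_mem _ ha hb) (Subgroup.inv_mem _ ha)
  have hb2 := h₂.bound (D.map f₂) (Subgroup.map_le_range f₂ D) (by
    rintro _ ⟨g, rfl⟩ _ ⟨d, hd, rfl⟩
    exact ⟨g * d * g⁻¹, hDn.conj_mem d hd g, by simp only [map_mul, map_inv]⟩)
  have hN₁pos : Nat.card N₁ ≠ 0 := by
    have : Finite N₁ := Finite.Set.subset (f₁.range : Set Γ) h₁.le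
    exact Nat.card_pos.ne'
  have hidx0 : D.index ≠ 0 := Subgroup.index_ne_zero_of_finite
  -- N₁ has order prime to p, so the p-part of |f₁(K)| is already that of [f₁(K) : N₁] = [K : D].
  have hp1 : p ^ (Nat.card f₁.range).factorization p = p ^ D.index.factorization p := by
    rw [← card_mul_relIndex_of_le h₁.le, ← hidx]
    exact ordProj_mul_of_not_dvd hN₁pos hidx0 h₁.not_dvd
  have hp2 : p ^ (Nat.card (D.map f₂)).factorization p ≤ p ^ (Nat.card D).factorization p :=
    ordProj_le_of_dvd Nat.card_pos.ne' (Subgroup.card_map_dvd D f₂)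
  have hp3 : p ^ (Nat.card D).factorization p * p ^ D.index.factorization p =
      p ^ (Nat.card K).factorization p := by
    rw [← D.card_mul_index, Nat.factorization_mul Nat.card_pos.ne' hidx0, Finsupp.add_apply, pow_add]
  rw [hp1] at hb1
  rw [hmul, ← hp3]
  calc 729 * (N₂.relIndex (D.map f₂) * N₁.relIndex f₁.range)
      = (27 * N₂.relIndex (D.map f₂)) * (27 * N₁.relIndex f₁.range) := by ring
    _ ≤ (c * (p ^ (Nat.card (D.map f₂)).factorization p) ^ 3) *
        (c * (p ^ D.index.factorization p) ^ 3) := Nat.mul_le_mul hb2 hb1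
    _ ≤ (c * (p ^ (Nat.card D).factorization p) ^ 3) *
        (c * (p ^ D.index.factorization p) ^ 3) := by gcongr
    _ = _ := by ring

/-- Equality holds for p ≥ 5; for p = 3 it is 7200 ≤ 7290, which is where the constant 10 comes
from. -/
theorem two_mul_pglTwoConst_sq_le {p : ℕ} (hp : p.Prime) (h2 : p ≠ 2) :
    2 * pglTwoConst p ^ 2 ≤ 729 * jordanConst p := by
  have h0 := hp.two_le
  have h4 : p ≠ 4 := by rintro rfl; exact absurd hp (by decide)
  have h6 : p ≠ 6 := by rintro rfl; exact absurd hp (by decide)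
  unfold pglTwoConst jordanConst
  split_ifs <;> omega

/-! ### Passing to the semidirect product with μ₂ -/

section Swap

variable {Γ : Type*} [Group Γ] (G : Subgroup ((Γ × Γ) ⋊[swapAction Γ] Multiplicative (ZMod 2)))

/-- The projection of a subgroup of `(Γ × Γ) ⋊ μ₂` to `μ₂`. -/
def swapSign : G →* Multiplicative (ZMod 2) := SemidirectProduct.rightHom.comp G.subtype

/-- The projection to `Γ × Γ` of the subgroup of elements not interchanging the factors. -/
def nonswapping : (swapSign G).ker →* Γ × Γ where
  toFun g := (g : (Γ × Γ) ⋊[swapAction Γ] Multiplicative (ZMod 2)).left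
  map_one' := rfl
  map_mul' a b := by
    have h : ((a : G) : (Γ × Γ) ⋊[swapAction Γ] Multiplicative (ZMod 2)).right = 1 := a.2
    simp [SemidirectProduct.mul_left, h]

theorem nonswapping_injective : Function.Injective (nonswapping G) := by
  intro a b h
  have ha : ((a : G) : (Γ × Γ) ⋊[swapAction Γ] Multiplicative (ZMod 2)).right = 1 := a.2
  have hb : ((b : G) : (Γ × Γ) ⋊[swapAction Γ] Multiplicative (ZMod 2)).right = 1 := b.2
  exact Subtype.ext (Subtype.ext (SemidirectProduct.ext h (ha.trans hb.symm)))

/-- The first projection on the elements not interchanging the factors. -/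
def swapFst : (swapSign G).ker →* Γ := (MonoidHom.fst Γ Γ).comp (nonswapping G)

/-- The second projection on the elements not interchanging the factors. -/
def swapSnd : (swapSign G).ker →* Γ := (MonoidHom.snd Γ Γ).comp (nonswapping G)

variable {G}

/-- The interchange in t acts on a before the left part of t multiplies it, so each coordinate of b
is conjugate to the opposite coordinate of a. -/
theorem swap_conj {t : G} (ht : swapSign G t ≠ 1) {a b : (swapSign G).ker}
    (h : t * (a : G) = b * t) :
    swapFst G b * (t : (Γ × Γ) ⋊[swapAction Γ] Multiplicative (ZMod 2)).left.1 =
        (t : (Γ × Γ) ⋊[swapAction Γ] Multiplicative (ZMod 2)).left.1 * swapSnd G a ∧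
      swapSnd G b * (t : (Γ × Γ) ⋊[swapAction Γ] Multiplicative (ZMod 2)).left.2 =
        (t : (Γ × Γ) ⋊[swapAction Γ] Multiplicative (ZMod 2)).left.2 * swapFst G a := by
  have hb : ((b : G) : (Γ × Γ) ⋊[swapAction Γ] Multiplicative (ZMod 2)).right = 1 := b.2
  have htr : (t : (Γ × Γ) ⋊[swapAction Γ] Multiplicative (ZMod 2)).right ≠ 1 := ht
  have h1 := congrArg (fun g : G =>
    (g : (Γ × Γ) ⋊[swapAction Γ] Multiplicative (ZMod 2)).left) h
  simp only [Subgroup.coe_mul, SemidirectProduct.mul_left, hb, map_one, MulAut.one_apply] at h1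
  have h2 : swapAction Γ (t : (Γ × Γ) ⋊[swapAction Γ] Multiplicative (ZMod 2)).right =
      MulEquiv.prodComm := if_neg htr
  rw [h2] at h1
  exact ⟨(congrArg Prod.fst h1).symm, (congrArg Prod.snd h1).symm⟩

theorem index_ker_swapSign_le : (swapSign G).ker.index ≤ 2 := by
  rw [Subgroup.index_ker]
  calc Nat.card (swapSign G).range ≤ Nat.card (Multiplicative (ZMod 2)) :=
        Subgroup.card_le_card_group _
    _ = 2 := by simp

theorem mul_mem_ker_of_not_mem {s t : G} (hs : swapSign G s ≠ 1) (ht : swapSign G t ≠ 1) :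
    s * t ∈ (swapSign G).ker := by
  have key : ∀ x y : Multiplicative (ZMod 2), x ≠ 1 → y ≠ 1 → x * y = 1 := by decide
  rw [MonoidHom.mem_ker, map_mul]
  exact key _ _ hs ht

variable {p : ℕ} [Finite G]

/-- Compatible choices of Jordan subgroups for the two projections. -/
theorem exists_compatible_jordan
    (hΓ : ∀ H : Subgroup Γ, Finite H → ∃ N, IsJordanSubgroup p H N) :
    ∃ N₁ N₂ : Subgroup Γ, IsJordanSubgroup p (swapFst G).range N₁ ∧
      IsJordanSubgroup p (swapSnd G).range N₂ ∧
      ((N₁.comap (swapFst G) ⊓ N₂.comap (swapSnd G)).map (swapSign G).ker.subtype).Normal := by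
  obtain ⟨N₁, hN₁⟩ := hΓ (swapFst G).range (Set.finite_range (swapFst G)).to_subtype
  have hker : ∀ N₂, IsJordanSubgroup p (swapSnd G).range N₂ → ∀ g : (swapSign G).ker,
      ∀ a ∈ N₁.comap (swapFst G) ⊓ N₂.comap (swapSnd G),
      g * a * g⁻¹ ∈ N₁.comap (swapFst G) ⊓ N₂.comap (swapSnd G) := by
    intro N₂ hN₂ g a ha
    refine ⟨?_, ?_⟩
    · change swapFst G _ ∈ N₁
      rw [map_mul, map_mul, map_inv]
      exact hN₁.conj_mem _ ⟨g, rfl⟩ _ ha.1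
    · change swapSnd G _ ∈ N₂
      rw [map_mul, map_mul, map_inv]
      exact hN₂.conj_mem _ ⟨g, rfl⟩ _ ha.2
  by_cases htop : ∃ t : G, swapSign G t ≠ 1
  · obtain ⟨t, ht⟩ := htop
    set x := (t : (Γ × Γ) ⋊[swapAction Γ] Multiplicative (ZMod 2)).left.1 with hx
    set y := (t : (Γ × Γ) ⋊[swapAction Γ] Multiplicative (ZMod 2)).left.2 with hy
    have hconjker : ∀ s : G, ∀ a : (swapSign G).ker, s * a * s⁻¹ ∈ (swapSign G).ker :=
      fun s a => (inferInstance : (swapSign G).ker.Normal).conj_mem a a.2 s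
    have hrange : (swapSnd G).range = (swapFst G).range.map (MulAut.conj y).toMonoidHom := by
      ext z
      constructor
      · rintro ⟨b, rfl⟩
        have hm : t⁻¹ * b * t ∈ (swapSign G).ker := by simpa using hconjker t⁻¹ b
        have h := (swap_conj ht (a := ⟨_, hm⟩) (b := b) (by simp [mul_assoc])).2
        refine ⟨_, ⟨⟨_, hm⟩, rfl⟩, ?_⟩
        change y * _ * y⁻¹ = _
        rw [← h, mul_inv_cancel_right]
      · rintro ⟨_, ⟨a, rfl⟩, rfl⟩
        have h := (swap_conj ht (a := a) (b := ⟨_, hconjker t a⟩) (by simp)).2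
        refine ⟨⟨_, hconjker t a⟩, ?_⟩
        change _ = y * _ * y⁻¹
        rw [← h, mul_inv_cancel_right]
    have hN₂ : IsJordanSubgroup p (swapSnd G).range (N₁.map (MulAut.conj y).toMonoidHom) :=
      hrange ▸ hN₁.map_conj y
    -- The square of t is (xy, yx). Conjugation by t brings yny⁻¹ to the first factor as
    -- (xy)n(xy)⁻¹, which stays in N₁ because xy lies in the first projection.
    have hxy : x * y ∈ (swapFst G).range := by
      refine ⟨⟨t * t, mul_mem_ker_of_not_mem ht ht⟩, ?_⟩
      have htr : (t : (Γ × Γ) ⋊[swapAction Γ] Multiplicative (ZMod 2)).right ≠ 1 := ht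
      have h2 : swapAction Γ (t : (Γ × Γ) ⋊[swapAction Γ] Multiplicative (ZMod 2)).right =
        MulEquiv.prodComm := if_neg htr
      change ((t * t : G) : (Γ × Γ) ⋊[swapAction Γ] Multiplicative (ZMod 2)).left.1 = _
      rw [Subgroup.coe_mul, SemidirectProduct.mul_left, h2]
      rfl
    have htconj : ∀ a ∈ N₁.comap (swapFst G) ⊓
        (N₁.map (MulAut.conj y).toMonoidHom).comap (swapSnd G),
        (⟨_, hconjker t a⟩ : (swapSign G).ker) ∈ N₁.comap (swapFst G) ⊓
        (N₁.map (MulAut.conj y).toMonoidHom).comap (swapSnd G) := by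
      rintro a ⟨ha1, n, hn, han⟩
      obtain ⟨h1, h2⟩ := swap_conj ht (a := a) (b := ⟨_, hconjker t a⟩) (by simp)
      rw [← hx] at h1
      rw [← hy] at h2
      refine ⟨?_, swapFst G a, ha1, ?_⟩
      · change swapFst G _ ∈ N₁
        rw [eq_mul_inv_of_mul_eq h1, ← han]
        have := hN₁.conj_mem _ hxy n hn
        change x * (y * n * y⁻¹) * x⁻¹ ∈ N₁
        rw [mul_inv_rev] at this
        simpa only [mul_assoc] using this
      · change y * _ * y⁻¹ = _
        rw [← h2, mul_inv_cancel_right]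
    refine ⟨N₁, _, hN₁, hN₂, ⟨?_⟩⟩
    rintro _ ⟨a, ha, rfl⟩ g
    -- An interchanging g is an element of the kernel times t, so normality reduces to conjugation
    -- by the kernel and by t.
    by_cases hg : swapSign G g = 1
    · exact ⟨_, hker _ hN₂ ⟨g, hg⟩ a ha, rfl⟩
    · have hu : g * t⁻¹ ∈ (swapSign G).ker := by
        apply mul_mem_ker_of_not_mem hg
        rwa [map_inv, Ne, inv_eq_one]
      refine ⟨_, hker _ hN₂ ⟨_, hu⟩ _ (htconj a ha), ?_⟩
      simp [mul_assoc]
  · push Not at htop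
    obtain ⟨N₂, hN₂⟩ := hΓ (swapSnd G).range (Set.finite_range (swapSnd G)).to_subtype
    refine ⟨N₁, N₂, hN₁, hN₂, ⟨?_⟩⟩
    rintro _ ⟨a, ha, rfl⟩ g
    exact ⟨_, hker _ hN₂ ⟨g, htop g⟩ a ha, rfl⟩

variable [Fact p.Prime]

/-- For p = 2 and a kernel of index two, the 2-part of |G| is twice that of the kernel, and 2 ≤ 2³
absorbs the index. For odd p the index is absorbed by J_p. -/
theorem ordProj_card_ker_swapSign :
    (swapSign G).ker.index * pglTwoConst p ^ 2 *
      (p ^ (Nat.card (swapSign G).ker).factorization p) ^ 3 ≤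
      729 * (jordanConst p * (p ^ (Nat.card G).factorization p) ^ 3) := by
  have hp : p.Prime := Fact.out
  have hle := ordProj_le_of_dvd (p := p) Nat.card_pos.ne'
    (Subgroup.card_subgroup_dvd_card (swapSign G).ker)
  have hidx := index_ker_swapSign_le (G := G)
  by_cases h2 : p = 2
  · subst h2
    have hc : pglTwoConst 2 = 27 := rfl
    have hJ : jordanConst 2 = 1 := rfl
    rw [hc, hJ]
    have hidx0 : (swapSign G).ker.index ≠ 0 := Subgroup.index_ne_zero_of_finite
    obtain h1 | h1 : (swapSign G).ker.index = 1 ∨ (swapSign G).ker.index = 2 := by omega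
    · rw [h1]
      have := Nat.pow_le_pow_left hle 3
      omega
    · have hcard := (swapSign G).ker.card_mul_index
      rw [h1] at hcard ⊢
      rw [← hcard, Nat.factorization_mul Nat.card_pos.ne' (by norm_num), Finsupp.add_apply, pow_add,
        Nat.prime_two.factorization_self, mul_pow]
      omega
  · have h3 := two_mul_pglTwoConst_sq_le hp h2
    calc _ ≤ 2 * pglTwoConst p ^ 2 * (p ^ (Nat.card G).factorization p) ^ 3 := by gcongr
      _ ≤ 729 * jordanConst p * (p ^ (Nat.card G).factorization p) ^ 3 := by gcongr
      _ = _ := by ring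

theorem exists_normal_abelian_of_swap
    (hΓ : ∀ H : Subgroup Γ, Finite H → ∃ N, IsJordanSubgroup p H N) :
    ∃ A : Subgroup G, A.Normal ∧ IsMulCommutative A ∧ (Nat.card A).Coprime p ∧
      ∀ S : Sylow p G, A.index ≤ jordanConst p * Nat.card S ^ 3 := by
  have hp : p.Prime := Fact.out
  obtain ⟨N₁, N₂, h₁, h₂, hn⟩ := exists_compatible_jordan (G := G) hΓ
  set A₀ := N₁.comap (swapFst G) ⊓ N₂.comap (swapSnd G) with hA₀
  refine ⟨_, hn, ⟨⟨?_⟩⟩, ?_, fun S => ?_⟩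
  · rintro ⟨_, a, ha, rfl⟩ ⟨_, b, hb, rfl⟩
    apply Subtype.ext
    change ((a * b : (swapSign G).ker) : G) = ((b * a : (swapSign G).ker) : G)
    congr 1
    apply nonswapping_injective
    rw [map_mul, map_mul]
    exact Prod.ext (h₁.comm _ ha.1 _ hb.1) (h₂.comm _ ha.2 _ hb.2)
  · rw [Subgroup.card_map_of_injective (Subgroup.subtype_injective _), Nat.coprime_comm,
      hp.coprime_iff_not_dvd]
    intro hd
    -- The order of A₀ divides |N₁|·|N₂|, which is prime to p.
    let f : A₀ →* N₁ × N₂ :=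
      (((swapFst G).comp A₀.subtype).codRestrict N₁ fun a => a.2.1).prod
        (((swapSnd G).comp A₀.subtype).codRestrict N₂ fun a => a.2.2)
    have hf : Function.Injective f := by
      intro a b h
      apply Subtype.ext
      apply nonswapping_injective
      exact Prod.ext (congrArg (fun z => ((z.1 : N₁) : Γ)) h)
        (congrArg (fun z => ((z.2 : N₂) : Γ)) h)
    have h3 := hd.trans (Subgroup.card_dvd_of_injective f hf)
    rw [Nat.card_prod] at h3
    rcases hp.dvd_mul.mp h3 with h | h
    · exact h₁.not_dvd h
    · exact h₂.not_dvd h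
  · have hS : Nat.card S = p ^ (Nat.card G).factorization p := S.card_eq_multiplicity
    have h3 := index_comap_inf_comap_le h₁ h₂
    have h4 : (A₀.map (swapSign G).ker.subtype).index = A₀.index * (swapSign G).ker.index :=
      Subgroup.index_map_subtype A₀
    rw [h4, hS]
    have h5 := ordProj_card_ker_swapSign (G := G) (p := p)
    have h6 : 729 * (A₀.index * (swapSign G).ker.index) ≤
        729 * (jordanConst p * (p ^ (Nat.card G).factorization p) ^ 3) :=
      calc _ = (729 * A₀.index) * (swapSign G).ker.index := by ring
        _ ≤ (pglTwoConst p ^ 2 * (p ^ (Nat.card (swapSign G).ker).factorization p) ^ 3) *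
            (swapSign G).ker.index := Nat.mul_le_mul_right _ h3
        _ = (swapSign G).ker.index * pglTwoConst p ^ 2 *
            (p ^ (Nat.card (swapSign G).ker).factorization p) ^ 3 := by ring
        _ ≤ _ := h5
    exact Nat.le_of_mul_le_mul_left h6 (by norm_num)

end Swap

/-! ### Criteria for Möbius-type actions -/

namespace IsMoebiusAction

theorem of_injective {p : ℕ} {G H X : Type*} [Group G] [Group H] [MulAction H X]
    (hH : IsMoebiusAction p H X) (f : G →* H) (hf : Function.Injective f) :
    letI : MulAction G X := MulAction.compHom X f
    IsMoebiusAction p G X := by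
  let _ : MulAction G X := MulAction.compHom X f
  have hpow : ∀ g : G, g ^ p = 1 ↔ f g ^ p = 1 := fun g => by
    rw [← map_pow, map_eq_one_iff f hf]
  refine ⟨fun g hg => ?_, fun x g h hg hh h1 h2 => ?_, fun x g h hg hh => ?_⟩
  · have h := hH.ncard_fixedBy (f g) (by rwa [Ne, map_eq_one_iff f hf])
    change (fixedBy X (f g)).ncard = _
    rw [h]
    by_cases h3 : g ^ p = 1
    · rw [if_pos h3, if_pos ((hpow g).mp h3)]
    · rw [if_neg h3, if_neg (mt (hpow g).mpr h3)]
  · rw [hpow, map_mul]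
    exact hH.mul_pow_eq_one x _ _ hg hh ((hpow g).mp h1) ((hpow h).mp h2)
  · rw [hpow, map_mul, map_mul, map_mul, map_inv, map_inv]
    exact hH.commutator_pow_eq_one x _ _ hg hh

/-- It suffices to check the conditions at one point of a transitive action. -/
theorem of_basePoint {p : ℕ} {G X : Type*} [Group G] [MulAction G X] (o : X)
    (htrans : ∀ x : X, ∃ a : G, a • o = x) (hfix : ∀ g : G, ∃ x : X, g • x = x)
    (h₁ : ∀ g : G, g ≠ 1 → g • o = o → g ^ p = 1 → (fixedBy X g).ncard = 1)
    (h₂ : ∀ g : G, g ≠ 1 → g • o = o → g ^ p ≠ 1 → (fixedBy X g).ncard = 2)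
    (hmul : ∀ g h : G, g • o = o → h • o = o → g ^ p = 1 → h ^ p = 1 → (g * h) ^ p = 1)
    (hcomm : ∀ g h : G, g • o = o → h • o = o → (g * h * g⁻¹ * h⁻¹) ^ p = 1) :
    IsMoebiusAction p G X := by
  have hconj : ∀ (a g : G), g • a • o = a • o → (a⁻¹ * g * a⁻¹⁻¹) • o = o := by
    intro a g h
    rw [inv_inv, mul_smul, mul_smul, h, inv_smul_smul]
  refine ⟨fun g hg => ?_, fun x g h hg hh h1 h2 => ?_, fun x g h hg hh => ?_⟩
  · obtain ⟨x, hx⟩ := hfix g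
    obtain ⟨a, rfl⟩ := htrans x
    have hc := hconj a g hx
    have hcard : (fixedBy X g).ncard = (fixedBy X (a⁻¹ * g * a⁻¹⁻¹)).ncard := by
      rw [← Set.ncard_image_of_injective (fixedBy X g) (MulAction.injective a⁻¹)]
      congr 1
      ext y
      simp only [Set.mem_image, mem_fixedBy, inv_inv]
      constructor
      · rintro ⟨z, hz, rfl⟩
        rw [mul_smul, mul_smul, smul_inv_smul, hz]
      · intro hy
        refine ⟨a • y, ?_, inv_smul_smul a y⟩
        rwa [mul_smul, mul_smul, inv_smul_eq_iff] at hy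
    have hne : a⁻¹ * g * a⁻¹⁻¹ ≠ 1 := by rwa [Ne, conj_eq_one_iff]
    rw [hcard]
    by_cases hp : g ^ p = 1
    · rw [if_pos hp]
      exact h₁ _ hne hc (conj_pow_eq_one_iff.mpr hp)
    · rw [if_neg hp]
      exact h₂ _ hne hc (mt conj_pow_eq_one_iff.mp hp)
  · obtain ⟨a, rfl⟩ := htrans x
    have := hmul _ _ (hconj a g hg) (hconj a h hh) (conj_pow_eq_one_iff.mpr h1)
      (conj_pow_eq_one_iff.mpr h2)
    rwa [conj_mul, conj_pow_eq_one_iff] at this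
  · obtain ⟨a, rfl⟩ := htrans x
    have := hcomm _ _ (hconj a g hg) (hconj a h hh)
    rwa [conj_inv, conj_inv, conj_mul, conj_mul, conj_mul, conj_pow_eq_one_iff] at this

end IsMoebiusAction

/-! ### `PGL₂` acting on the projective line -/

namespace Matrix.ProjGenLinGroup

open OnePoint

variable {K : Type*} [Field K]

theorem mk_eq_one_iff_fin_two (g : GL (Fin 2) K) :
    mk g = 1 ↔ g 0 1 = 0 ∧ g 1 0 = 0 ∧ g 0 0 = g 1 1 := by
  rw [mk_eq_one, GeneralLinearGroup.center_eq_range_scalar]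
  constructor
  · rintro ⟨u, rfl⟩
    simp
  · rintro ⟨h1, h2, h3⟩
    have h0 : g 0 0 ≠ 0 := by
      intro h
      apply g.det_ne_zero
      rw [det_fin_two, h, h2]
      simp
    refine ⟨Units.mk0 _ h0, ?_⟩
    ext i j
    fin_cases i <;> fin_cases j <;> simp [h1, h2, h3]

theorem map_injective_fin_two {L : Type*} [Field L] (f : K →+* L) :
    Function.Injective (map (n := Fin 2) f) := by
  rw [injective_iff_map_eq_one]
  intro g hg
  induction g using Matrix.ProjGenLinGroup.induction_on with | mk g =>
  rw [map_mk, mk_eq_one_iff_fin_two] at hg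
  rw [mk_eq_one_iff_fin_two]
  simpa [f.injective.eq_iff] using hg

/-- The factor `g 0 0` in the last clause avoids the exponent n - 1. For n = p that clause makes the
corner entry vanish in characteristic p. -/
theorem pow_apply_of_upperTriangular {g : GL (Fin 2) K} (hg : g 1 0 = 0) (n : ℕ) :
    (g ^ n) 1 0 = 0 ∧ (g ^ n) 0 0 = g 0 0 ^ n ∧ (g ^ n) 1 1 = g 1 1 ^ n ∧
      (g 0 0 = g 1 1 → g 0 0 * (g ^ n) 0 1 = n * g 0 0 ^ n * g 0 1) := by
  induction n with
  | zero => simp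
  | succ n ih =>
    obtain ⟨h1, h2, h3, h4⟩ := ih
    simp only [pow_succ, GeneralLinearGroup.coe_mul, Matrix.mul_apply, Fin.sum_univ_two, h1, h2, h3,
      hg]
    refine ⟨by ring, by ring, by ring, fun h => ?_⟩
    rw [mul_add, ← mul_assoc (g 0 0) ((g ^ n) 0 1), h4 h, ← h]
    push_cast
    ring

theorem apply_ne_zero_of_upperTriangular {g : GL (Fin 2) K} (hg : g 1 0 = 0) :
    g 0 0 ≠ 0 ∧ g 1 1 ≠ 0 := by
  have := g.det_ne_zero
  rw [det_fin_two, hg, mul_zero, sub_zero] at this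
  exact ⟨left_ne_zero_of_mul this, right_ne_zero_of_mul this⟩

/-- Frobenius is injective, so equal p-th powers of the diagonal entries force equal entries. -/
theorem mk_pow_eq_one_iff {p : ℕ} [Fact p.Prime] [CharP K p] {g : GL (Fin 2) K} (hg : g 1 0 = 0) :
    mk g ^ p = 1 ↔ g 0 0 = g 1 1 := by
  obtain ⟨h1, h2, h3, h4⟩ := pow_apply_of_upperTriangular hg p
  rw [← map_pow, mk_eq_one_iff_fin_two, h1, h2, h3]
  constructor
  · rintro ⟨-, -, h⟩
    exact frobenius_inj K p h
  · intro h
    refine ⟨?_, rfl, by rw [h]⟩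
    have := h4 h
    rw [CharP.cast_eq_zero, zero_mul, zero_mul] at this
    exact (mul_eq_zero.mp this).resolve_left (apply_ne_zero_of_upperTriangular hg).1

variable [DecidableEq K]

theorem scalar_smul_onePoint (u : Kˣ) (x : OnePoint K) :
    GeneralLinearGroup.scalar (Fin 2) u • x = x := by
  cases x with
  | infty => rw [smul_infty_eq_self_iff]; simp
  | coe x => rw [smul_some_eq_ite]; simp

/-- The action of `PGL₂` on the projective line by Möbius transformations. -/
instance : MulAction (ProjGenLinGroup (Fin 2) K) (OnePoint K) :=
  mulActionOfGL scalar_smul_onePoint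

theorem mk_smul_onePoint (g : GL (Fin 2) K) (x : OnePoint K) : mk g • x = g • x := rfl

theorem smul_coe_eq_self_iff_of_upperTriangular {g : GL (Fin 2) K} (hg : g 1 0 = 0) (z : K) :
    g • (z : OnePoint K) = z ↔ (g 1 1 - g 0 0) * z = g 0 1 := by
  rw [smul_some_eq_ite, hg, zero_mul, zero_add,
    if_neg (apply_ne_zero_of_upperTriangular hg).2, OnePoint.coe_eq_coe,
    div_eq_iff (apply_ne_zero_of_upperTriangular hg).2]
  constructor <;> intro h <;> linear_combination -h

theorem exists_smul_eq_self [IsAlgClosed K] (g : GL (Fin 2) K) : ∃ x : OnePoint K, g • x = x := by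
  by_cases h : g 1 0 = 0
  · exact ⟨∞, smul_infty_eq_self_iff.mpr h⟩
  · have hdeg : g.fixpointPolynomial.degree ≠ 0 := by
      have : g.fixpointPolynomial = Polynomial.C (g 1 0) * Polynomial.X ^ 2 +
          Polynomial.C (g 1 1 - g 0 0) * Polynomial.X + Polynomial.C (-g 0 1) := by
        rw [GeneralLinearGroup.fixpointPolynomial]
        simp only [map_sub, map_neg]
        ring
      rw [this, Polynomial.degree_quadratic h]
      decide
    obtain ⟨z, hz⟩ := IsAlgClosed.exists_root _ hdeg
    refine ⟨z, GeneralLinearGroup.fixpointPolynomial_aeval_eq_zero_iff.mp ?_⟩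
    rwa [Polynomial.coe_aeval_eq_eval]

/-- The stabilizer of ∞ is the upper triangular group. Equal diagonal entries give a translation,
fixing only ∞ unless trivial; distinct ones give one further, finite fixed point. Commutators of
triangular matrices have diagonal 1. -/
theorem isMoebiusAction (p : ℕ) [Fact p.Prime] [CharP K p] [IsAlgClosed K] :
    IsMoebiusAction p (ProjGenLinGroup (Fin 2) K) (OnePoint K) := by
  refine IsMoebiusAction.of_basePoint ∞ ?_ ?_ ?_ ?_ ?_ ?_
  · intro x
    cases x with
    | infty => exact ⟨1, one_smul _ _⟩
    | coe z =>
      refine ⟨mk (GeneralLinearGroup.mkOfDetNeZero !![z, 1; 1, 0] (by simp)), ?_⟩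
      rw [mk_smul_onePoint, smul_infty_eq_ite]
      simp [GeneralLinearGroup.mkOfDetNeZero]
  · intro g
    induction g using Matrix.ProjGenLinGroup.induction_on with | mk g =>
    exact exists_smul_eq_self g
  · intro g hg hgo hgp
    induction g using Matrix.ProjGenLinGroup.induction_on with | mk g =>
    have hg0 : g 1 0 = 0 := smul_infty_eq_self_iff.mp hgo
    rw [mk_pow_eq_one_iff hg0] at hgp
    rw [Set.ncard_eq_one]
    refine ⟨∞, Set.eq_singleton_iff_unique_mem.mpr ⟨hgo, fun x hx => ?_⟩⟩
    cases x with
    | infty => rfl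
    | coe z =>
      exfalso
      have h1 := (smul_coe_eq_self_iff_of_upperTriangular hg0 z).mp hx
      rw [hgp, sub_self, zero_mul] at h1
      exact hg ((mk_eq_one_iff_fin_two g).mpr ⟨h1.symm, hg0, hgp⟩)
  · intro g hg hgo hgp
    induction g using Matrix.ProjGenLinGroup.induction_on with | mk g =>
    have hg0 : g 1 0 = 0 := smul_infty_eq_self_iff.mp hgo
    rw [Ne, mk_pow_eq_one_iff hg0] at hgp
    have hd : g 1 1 - g 0 0 ≠ 0 := fun h => hgp (sub_eq_zero.mp h).symm
    rw [Set.ncard_eq_two]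
    refine ⟨∞, (g 0 1 / (g 1 1 - g 0 0) : K), infty_ne_coe _, ?_⟩
    ext x
    cases x with
    | infty => simpa using hgo
    | coe z =>
      have h1 := smul_coe_eq_self_iff_of_upperTriangular hg0 z
      rw [mem_fixedBy, mk_smul_onePoint, h1, Set.mem_insert_iff, Set.mem_singleton_iff,
        OnePoint.coe_eq_coe, eq_div_iff hd, mul_comm]
      simp
  · intro g h hgo hho hgp hhp
    induction g using Matrix.ProjGenLinGroup.induction_on with | mk g =>
    induction h using Matrix.ProjGenLinGroup.induction_on with | mk h =>
    have hg0 : g 1 0 = 0 := smul_infty_eq_self_iff.mp hgo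
    have hh0 : h 1 0 = 0 := smul_infty_eq_self_iff.mp hho
    have hgh : (g * h) • (∞ : OnePoint K) = ∞ := by
      rw [mul_smul, smul_infty_eq_self_iff.mpr hh0, smul_infty_eq_self_iff.mpr hg0]
    rw [mk_pow_eq_one_iff hg0] at hgp
    rw [mk_pow_eq_one_iff hh0] at hhp
    rw [← map_mul, mk_pow_eq_one_iff (smul_infty_eq_self_iff.mp hgh)]
    simp [Matrix.mul_apply, Fin.sum_univ_two, hg0, hh0, hgp, hhp]
  · intro g h hgo hho
    induction g using Matrix.ProjGenLinGroup.induction_on with | mk g =>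
    induction h using Matrix.ProjGenLinGroup.induction_on with | mk h =>
    have hg0 : g 1 0 = 0 := smul_infty_eq_self_iff.mp hgo
    have hh0 : h 1 0 = 0 := smul_infty_eq_self_iff.mp hho
    set c := g * h * g⁻¹ * h⁻¹ with hc
    have hc0 : c 1 0 = 0 := by
      apply smul_infty_eq_self_iff.mp
      have h1 := smul_infty_eq_self_iff.mpr hg0
      have h2 := smul_infty_eq_self_iff.mpr hh0
      have h1' : g⁻¹ • (∞ : OnePoint K) = ∞ := by rw [inv_smul_eq_iff, h1]
      have h2' : h⁻¹ • (∞ : OnePoint K) = ∞ := by rw [inv_smul_eq_iff, h2]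
      rw [hc, mul_smul, mul_smul, mul_smul, h2', h1', h2, h1]
    have hchg : c * (h * g) = g * h := by rw [hc]; group
    have e0 : c 0 0 * (h 0 0 * g 0 0) = g 0 0 * h 0 0 := by
      have := congrArg (fun m : GL (Fin 2) K => m 0 0) hchg
      simpa [Matrix.mul_apply, Fin.sum_univ_two, hg0, hh0] using this
    have e1 : c 1 1 * (h 1 1 * g 1 1) = g 1 1 * h 1 1 := by
      have := congrArg (fun m : GL (Fin 2) K => m 1 1) hchg
      simpa [Matrix.mul_apply, Fin.sum_univ_two, hg0, hh0, hc0] using this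
    obtain ⟨ga, gd⟩ := apply_ne_zero_of_upperTriangular hg0
    obtain ⟨ha, hd⟩ := apply_ne_zero_of_upperTriangular hh0
    have c0 : c 0 0 = 1 := mul_right_cancel₀ (mul_ne_zero ha ga) (by rw [e0]; ring)
    have c1 : c 1 1 = 1 := mul_right_cancel₀ (mul_ne_zero hd gd) (by rw [e1]; ring)
    rw [← map_inv, ← map_inv, ← map_mul, ← map_mul, ← map_mul, ← hc, mk_pow_eq_one_iff hc0, c0, c1]

end Matrix.ProjGenLinGroup

/-! ### The theorem, by embedding into `PGL₂` of the algebraic closure -/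

theorem corollary7p4 {k : Type*} [Field k] (p : ℕ) [Fact p.Prime] [CharP k p]
    (G : Subgroup (PGLTwoSwap k)) [Finite G] :
    ∃ A : Subgroup G, A.Normal ∧ IsMulCommutative A ∧ (Nat.card A).Coprime p ∧
      ∀ S : Sylow p G, A.index ≤ jordanConst p * Nat.card S ^ 3 := by
  classical
  have : CharP (AlgebraicClosure k) p :=
    charP_of_injective_algebraMap (algebraMap k (AlgebraicClosure k)).injective p
  have hK := Matrix.ProjGenLinGroup.isMoebiusAction (K := AlgebraicClosure k) p
  let f := Matrix.ProjGenLinGroup.map (n := Fin 2) (algebraMap k (AlgebraicClosure k))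
  let _ : MulAction (Matrix.ProjGenLinGroup (Fin 2) k) (OnePoint (AlgebraicClosure k)) :=
    MulAction.compHom _ f
  have hk : IsMoebiusAction p (Matrix.ProjGenLinGroup (Fin 2) k)
      (OnePoint (AlgebraicClosure k)) :=
    hK.of_injective f (Matrix.ProjGenLinGroup.map_injective_fin_two _)
  exact exists_normal_abelian_of_swap fun H _ => hk.exists_isJordanSubgroup H
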